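/- **Conventions.** A problem is a partial multivalued function $f:\subseteq\mathbb N^{\mathbb N}\rightrightarrows\mathbb N^{\mathbb N}$ on Baire space; composition is $g\circ f(x)=\{z:(\exists y\in f(x))\,z\in g(y)\}$ with domain $\{x\in\mathrm{dom}(f):f(x)\subseteq\mathrm{dom}(g)\}$. Let $\langle q,p\rangle=q(0)p(0)q(1)p(1)\dots$, let $\langle p_0,p_1,p_2,\dots\rangle$ be the standard infinite tupling on Baire space, and let $\langle\mathrm{id}\times f\rangle$ be the problem $\langle q,p\rangle\mapsto\{\langle q,r\rangle:r\in f(p)\}$. A partial function $F$ on Baire space is computable if there is a computable monotone word function $w:\mathbb N^*\to\mathbb N^*$ with $F(p)=\sup_{v\sqsubseteq p}w(v)$ for all $p\in\mathrm{dom}(F)$. Let $\mathsf U\langle q,p\rangle=\Phi_q(p)$ be the computable universal function, where $\Phi_q$ is the continuous partial function (with its natural domain) whose approximating monotone word function is encoded as a list by $q$; the digits $0,1,2$ are dummy symbols in such names $q$. A partial function $G$ on Baire space realizes a problem $g$ if $G(p)$ is defined and $G(p)\in g(p)$ for all $p\in\mathrm{dom}(g)$. We write $f\le_{\mathrm W}g$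 (respectively $f\le_{\mathrm{sW}}g$) if there are computable partial functions $H,K$ such that $H\langle\mathrm{id},GK\rangle$ (respectively $HGK$) realizes $f$ whenever $G$ realizes $g$; $\equiv_{\mathrm{sW}}$ is the equivalence belonging to $\le_{\mathrm{sW}}$. A problem $f$ is pointed if $\mathrm{id}\le_{\mathrm W}f$. For a problem $f$ put $\ell_f:=\mathsf U\circ\langle\mathrm{id}\times f\rangle$. * *Inverse limit:* $f^\infty(q_0)=\{\langle q_0,q_1,q_2,\dots\rangle:(\forall i)\;q_{i+1}\in\ell_f(q_i)\}$, defined for those $q_0$ such that $A_i\subseteq\mathrm{dom}(\ell_f)$ for all $i$, where $A_0=\{q_0\}$ and $A_{i+1}=\ell_f(A_i)$. * *Omega operation:* $f^{[0]}=\mathrm{id}$, $f^{[1]}=\langle\mathrm{id}\times f\rangle$, $f^{[n+1]}=\langle\mathrm{id}\times f\rangle\circ\mathsf U\circ f^{[n]}$ for $n\ge1$, and $f^\omega(p)=\langle f^{[0]}(p),f^{[1]}(p),f^{[2]}(p),\dots\rangle$ (the set of all tuples of elements), defined for those $p$ that lie in $\mathrm{dom}(f^{[n]})$ for all $n$. *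 *Diamond:* $f^\diamond(q_0)$ is the set of all $q_k$, $k\ge0$, for which there are $q_1,\dots,q_{k-1}$ with $q_{i+1}\in\ell_f(q_i)$ for all $i<k$, $q_k(0)=0$ and $q_i(0)\ne0$ for all $i<k$. It is defined for those $q_0$ from which there is neither a finite run $q_0,\dots,q_k$ (i.e. $q_{i+1}\in\ell_f(q_i)$ for $i<k$) with $q_k\notin\mathrm{dom}(\ell_f)$ and $q_i(0)\neq0$ for all $i\le k$, nor an infinite run with $q_i(0)\ne0$ for all $i$. * *Parallelization:* $\widehat f\langle p_0,p_1,\dots\rangle=\{\langle r_0,r_1,\dots\rangle:(\forall i)\;r_i\in f(p_i)\}$. **Statement.** For every single-valued problem $F:\subseteq\mathbb N^{\mathbb N}\to\mathbb N^{\mathbb N}$, $$F^\omega\equiv_{\mathrm{sW}}F^\infty.$$ If, in addition, $F$ is pointed, then $$F^\infty\equiv_{\mathrm{sW}}F^\omega\equiv_{\mathrm{sW}}\widehat{F^\diamond}.$$ -/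

import Mathlib

namespace Weihrauch

/-! ### Baire space, pairing and tupling -/

/-- Baire space `ℕ^ℕ`. -/
abbrev Baire : Type := ℕ → ℕ

/-- The pairing `⟨q, p⟩ = q(0) p(0) q(1) p(1) ⋯`. -/
def pair (q p : Baire) : Baire := fun n => if n % 2 = 0 then q (n / 2) else p (n / 2)

/-- The first component of a sequence read as a pair. -/
def left (x : Baire) : Baire := fun n => x (2 * n)

/-- The second component of a sequence read as a pair. -/
def right (x : Baire) : Baire := fun n => x (2 * n + 1)

theorem left_pair (q p : Baire) : left (pair q p) = q := by
  funext n
  simp [left, pair]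

theorem right_pair (q p : Baire) : right (pair q p) = p := by
  funext n
  have h1 : (2 * n + 1) % 2 = 1 := by omega
  have h2 : (2 * n + 1) / 2 = n := by omega
  simp [right, pair, h1, h2]

theorem pair_left_right (x : Baire) : pair (left x) (right x) = x := by
  funext n
  rcases Nat.mod_two_eq_zero_or_one n with h | h
  · have h2 : 2 * (n / 2) = n := by omega
    simp [left, pair, h, h2]
  · have h2 : 2 * (n / 2) + 1 = n := by omega
    simp [right, pair, h, h2]

/-- The infinite tupling `⟨p₀, p₁, p₂, …⟩`, with `⟨p₀, p₁, …⟩⟨i, j⟩ = pᵢ(j)`. -/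
def tuple (p : ℕ → Baire) : Baire := fun n => p n.unpair.1 n.unpair.2

/-- The `i`-th component of a sequence read as an infinite tuple. -/
def component (x : Baire) (i : ℕ) : Baire := fun j => x (Nat.pair i j)

theorem component_tuple (p : ℕ → Baire) (i : ℕ) : component (tuple p) i = p i := by
  funext j
  simp [component, tuple]

theorem tuple_component (x : Baire) : tuple (component x) = x := by
  funext n
  simp [component, tuple]

/-! ### Computable partial functions on Baire space -/

/-- The prefix of length `n` of an infinite sequence. -/
def take (p : Baire) (n : ℕ) : List ℕ := (List.range n).map p

/-- A word function is monotone if it respects the prefix order. -/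
def MonotoneWord (f : List ℕ → List ℕ) : Prop :=
  ∀ v w : List ℕ, v <+: w → f v <+: f w

/-- `f` approximates `F`: one has `F(p) = sup_{w ⊑ p} f(w)` for all `p ∈ dom F`. -/
def Approximates (f : List ℕ → List ℕ) (F : Baire →. Baire) : Prop :=
  ∀ p r : Baire, r ∈ F p →
    (∀ n : ℕ, f (take p n) = take r (f (take p n)).length) ∧
      ∀ m : ℕ, ∃ n : ℕ, m ≤ (f (take p n)).length

/-- A partial function on Baire space is computable if some computable monotone word function
approximates it. -/
def ComputableFun (F : Baire →. Baire) : Prop :=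
  ∃ f : List ℕ → List ℕ, Computable f ∧ MonotoneWord f ∧ Approximates f F

/-! ### The universal function

A name `q` lists pairs `(w, v)` of words: a digit `d + 3` stands for the pair with number `d`, and
the digits `0`, `1`, `2` are dummy symbols without meaning. The pair `(w, v)` says that on every
input which extends `w`, the output extends `v`. If `q` lists the graph of a monotone word
function `f`, then `Phi q` is the function `p ↦ sup_{w ⊑ p} f(w)`, defined for all `p` for which
this supremum is infinite. In an arbitrary name the pairs are used in the order in which they are
listed, and those which contradict the output that is already produced are skipped. -/

/-- The output after reading the digit `d` of the name, if the output so far is `v`. -/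
def phiStep (p : Baire) (v : List ℕ) (d : ℕ) : List ℕ :=
  if d < 3 then v
  else
    let e : List ℕ × List ℕ := Denumerable.ofNat (List ℕ × List ℕ) (d - 3)
    if e.1 = take p e.1.length ∧ v <+: e.2 then e.2 else v

/-- The finite output produced from the first `k` digits of the name `q` on input `p`. -/
def phiRun (q p : Baire) : ℕ → List ℕ
  | 0 => []
  | k + 1 => phiStep p (phiRun q p k) (q k)

/-- The partial continuous function `Φ_q` with name `q`; it is defined on `p` if the output
produced in the limit is infinite. -/
def Phi (q : Baire) : Baire →. Baire := fun p =>
  ⟨∀ n : ℕ, ∃ k : ℕ, n < (phiRun q p k).length,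
    fun h n => (phiRun q p (Nat.find (h n)))[n]'(Nat.find_spec (h n))⟩

/-- The universal function `U⟨q, p⟩ = Φ_q(p)`. -/
def univ : Baire →. Baire := fun x => Phi (left x) (right x)

/-! ### Problems -/

/-- A problem on Baire space, that is, a partial multivalued function: `f p` is the set of
solutions of the instance `p`, and the domain consists of all `p` with `f p` nonempty. -/
abbrev Problem : Type := Baire → Set Baire

namespace Problem

/-- The domain of a problem. -/
def dom (f : Problem) : Set Baire := {p | (f p).Nonempty}

/-- A single-valued partial function as a problem. -/
def ofFun (F : Baire →. Baire) : Problem := fun p => {r | r ∈ F p}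

/-- The identity of Baire space. -/
def ident : Problem := fun p => {p}

/-- The composition `g ∘ f`, with domain `{x ∈ dom f | f x ⊆ dom g}`. -/
def comp (g f : Problem) : Problem := fun x =>
  {z | x ∈ f.dom ∧ f x ⊆ g.dom ∧ ∃ y ∈ f x, z ∈ g y}

/-- The problem `⟨id × f⟩`, which maps `⟨q, p⟩` to all `⟨q, r⟩` with `r ∈ f p`. -/
def idTimes (f : Problem) : Problem := fun x =>
  {z | ∃ r ∈ f (right x), z = pair (left x) r}

/-- One pass of the loop on `f`: the problem `U ∘ ⟨id × f⟩`. -/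
def loop (f : Problem) : Problem := (ofFun univ).comp f.idTimes

/-! ### Inverse limit -/

/-- The sets `A₀ = {q₀}` and `Aᵢ₊₁ = (U ∘ ⟨id × f⟩)(Aᵢ)`. -/
def reach (f : Problem) (q₀ : Baire) : ℕ → Set Baire
  | 0 => {q₀}
  | i + 1 => ⋃ q ∈ reach f q₀ i, f.loop q

/-- The inverse limit `f^∞`. -/
def inverseLimit (f : Problem) : Problem := fun q₀ =>
  {z | (∀ i : ℕ, f.reach q₀ i ⊆ f.loop.dom) ∧
    ∃ q : ℕ → Baire, q 0 = q₀ ∧ (∀ i : ℕ, q (i + 1) ∈ f.loop (q i)) ∧ z = tuple q}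

/-! ### Omega operation -/

/-- The repeated compositional products `f^[n]`: `f^[0] = id`, `f^[1] = ⟨id × f⟩` and
`f^[n+1] = ⟨id × f⟩ ∘ U ∘ f^[n]` for `n ≥ 1`. -/
def power (f : Problem) : ℕ → Problem
  | 0 => ident
  | 1 => f.idTimes
  | n + 2 => f.idTimes.comp ((ofFun univ).comp (power f (n + 1)))

/-- The omega operation `f^ω(p) = ⟨f^[0](p), f^[1](p), f^[2](p), …⟩`, defined for all `p` in the
domains of all `f^[n]`. -/
def omega (f : Problem) : Problem := fun p =>
  {z | ∃ r : ℕ → Baire, (∀ n : ℕ, r n ∈ f.power n p) ∧ z = tuple r}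

/-! ### Diamond operator and parallelization -/

/-- `q 0, …, q k` is a finite run of the loop on `f`. -/
def FiniteRun (f : Problem) (q : ℕ → Baire) (k : ℕ) : Prop :=
  ∀ i < k, q (i + 1) ∈ f.loop (q i)

/-- The finite run `q 0, …, q k` is successful. -/
def Successful (f : Problem) (q : ℕ → Baire) (k : ℕ) : Prop :=
  f.FiniteRun q k ∧ q k 0 = 0 ∧ ∀ i < k, q i 0 ≠ 0

/-- The finite run `q 0, …, q k` stalls. -/
def Stalls (f : Problem) (q : ℕ → Baire) (k : ℕ) : Prop :=
  f.FiniteRun q k ∧ q k ∉ f.loop.dom ∧ ∀ i ≤ k, q i 0 ≠ 0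

/-- `q 0, q 1, …` is an infinite unsuccessful run. -/
def InfiniteUnsuccessful (f : Problem) (q : ℕ → Baire) : Prop :=
  (∀ i : ℕ, q (i + 1) ∈ f.loop (q i)) ∧ ∀ i : ℕ, q i 0 ≠ 0

/-- The diamond operator `f^◇`: the solutions are the final values of successful finite runs, and
the domain consists of all `q₀` from which no run stalls or is infinite and unsuccessful. -/
def diamond (f : Problem) : Problem := fun q₀ =>
  {z | (∀ q : ℕ → Baire, q 0 = q₀ → (∀ k : ℕ, ¬ f.Stalls q k) ∧ ¬ f.InfiniteUnsuccessful q) ∧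
    ∃ (q : ℕ → Baire) (k : ℕ), q 0 = q₀ ∧ f.Successful q k ∧ z = q k}

/-- The parallelization, which maps `⟨p₀, p₁, …⟩` to all `⟨r₀, r₁, …⟩` with `rᵢ ∈ f pᵢ`. -/
def parallelization (f : Problem) : Problem := fun x =>
  {z | ∀ i : ℕ, component z i ∈ f (component x i)}

/-! ### Weihrauch reducibility -/

/-- `G` is a realizer of `f`. -/
def Realizes (G : Baire →. Baire) (f : Problem) : Prop :=
  ∀ p ∈ f.dom, ∃ r ∈ G p, r ∈ f p

/-- Weihrauch reducibility: `H⟨id, GK⟩` realizes `f` whenever `G` realizes `g`. -/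
def WeihrauchLE (f g : Problem) : Prop :=
  ∃ H K : Baire →. Baire, ComputableFun H ∧ ComputableFun K ∧
    ∀ G : Baire →. Baire, Realizes G g →
      Realizes (fun p => ((K p).bind G).bind fun r => H (pair p r)) f

/-- Strong Weihrauch reducibility: `HGK` realizes `f` whenever `G` realizes `g`. -/
def StrongWeihrauchLE (f g : Problem) : Prop :=
  ∃ H K : Baire →. Baire, ComputableFun H ∧ ComputableFun K ∧
    ∀ G : Baire →. Baire, Realizes G g → Realizes (fun p => ((K p).bind G).bind H) f

/-- Strong Weihrauch equivalence. -/
def StrongWeihrauchEquiv (f g : Problem) : Prop :=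
  StrongWeihrauchLE f g ∧ StrongWeihrauchLE g f

/-- A problem is pointed if the identity is Weihrauch reducible to it. -/
def Pointed (f : Problem) : Prop := WeihrauchLE ident f

end Problem

end Weihrauch

namespace Weihrauch

/-! ### Prefixes -/

/-! For single-valued `F` the loop `U ∘ ⟨id × F⟩` is deterministic. All domain conditions, which
quantify over every run, then follow from the existence of one suitable run (`mem_inverseLimit`,
`mem_omega`, `mem_diamond`), and different queries to a realizer are answered consistently along
that run.

The reduction of `F^∞` to `F^ω` is immediate: each component of `F^ω` after the zeroth is a point to
which `U` can be applied, and this gives the next member of the run. The other reductions need the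
loop to carry extra information. This is the purpose of `exists_encoding`: any computable step on
states `x` that uses one value of `F`, at a point `B x`, can be performed by one pass of the loop.
The recursion theorem supplies a program that, given `x` and the answer, writes a name containing
that same program with the next state as parameter. The state itself is written into the name with
the dummy digits `0` and `1`, so it can be read off without affecting what the name computes.

With states `⟨q, s⟩` that remember the intermediate value `s`, the inverse limit computes `F^ω`.
With states `⟨n n n …, q⟩` and a counter that decreases, a diamond stops after exactly `n` passes,
so parallel diamonds deliver all members of the run of `F^∞`. Conversely, the inverse limit
dovetails countably many diamond runs in one state. A run that has already halted offers no query,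
but every pass of the loop must make one; pointedness provides a computable point of the domain of
`F` for this purpose (`exists_computable_mem_dom`).

Computability is handled through `EffectiveRel`: digits are computed from finite prefixes by
monotone approximations. -/

@[simp]
theorem length_take (p : Baire) (n : ℕ) : (take p n).length = n := by
  simp [take]

theorem getElem?_take (p : Baire) {n i : ℕ} (h : i < n) : (take p n)[i]? = some (p i) := by
  simp [take, h]

theorem prefix_take_iff {l : List ℕ} {p : Baire} {n : ℕ} :
    l <+: take p n ↔ l.length ≤ n ∧ l = take p l.length := by
  constructor
  · intro h
    have hl : l.length ≤ n := by simpa using h.length_le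
    refine ⟨hl, List.ext_getElem? fun i => ?_⟩
    rcases lt_or_ge i l.length with hi | hi
    · have := List.prefix_iff_getElem?.1 h i hi
      rw [getElem?_take p (hi.trans_le hl)] at this
      rw [getElem?_take p hi, this, List.getElem?_eq_getElem hi]
    · rw [List.getElem?_eq_none hi, List.getElem?_eq_none (by simpa using hi)]
  · rintro ⟨hl, h⟩
    refine List.prefix_iff_getElem?.2 fun i hi => ?_
    rw [getElem?_take p (hi.trans_le hl), ← List.getElem?_eq_getElem hi]
    conv_rhs => rw [h]
    rw [getElem?_take p hi]

theorem take_prefix_take (p : Baire) {m n : ℕ} (h : m ≤ n) : take p m <+: take p n := by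
  rw [prefix_take_iff]
  simpa using h

theorem prefix_of_length_le {v w : List ℕ} {r : Baire} (hv : v = take r v.length)
    (hw : w = take r w.length) (h : v.length ≤ w.length) : v <+: w := by
  rw [hv, hw]
  exact take_prefix_take r h

/-! ### Words built from partially known functions -/

/-- The values `h 0, h 1, …` up to the first undefined one, and at most `k` of them. -/
def build (h : ℕ → Option ℕ) : ℕ → List ℕ
  | 0 => []
  | k + 1 => (h (build h k).length).elim (build h k) fun b => build h k ++ [b]

theorem length_build_le (h : ℕ → Option ℕ) (k : ℕ) : (build h k).length ≤ k := by
  induction k with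
  | zero => simp [build]
  | succ k ih =>
    rw [build]
    cases h (build h k).length with
    | none => simpa using ih.trans (Nat.le_succ k)
    | some b => simpa using ih

theorem build_getElem? {h : ℕ → Option ℕ} {k i b : ℕ} (hb : (build h k)[i]? = some b) :
    h i = some b := by
  induction k with
  | zero => simp [build] at hb
  | succ k ih =>
    rw [build] at hb
    cases hh : h (build h k).length with
    | none => rw [hh] at hb; exact ih hb
    | some c =>
      rw [hh, Option.elim_some] at hb
      rcases lt_trichotomy i (build h k).length with hi | hi | hi
      · rw [List.getElem?_append_left hi] at hb
        exact ih hb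
      · subst hi
        rw [List.getElem?_concat_length] at hb
        rw [hh, hb]
      · rw [List.getElem?_eq_none (by simpa using hi)] at hb
        cases hb

theorem lt_length_build {h : ℕ → Option ℕ} {k i : ℕ} (hi : i < k)
    (hs : ∀ j ≤ i, (h j).isSome) : i < (build h k).length := by
  induction k with
  | zero => omega
  | succ k ih =>
    rw [build]
    cases hh : h (build h k).length with
    | none =>
      by_contra hc
      have := hs (build h k).length (by simpa using hc)
      simp [hh] at this
    | some c =>
      rcases Nat.lt_succ_iff_lt_or_eq.1 hi with hi | rfl
      · have := ih hi
        simp only [Option.elim_some, List.length_append]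
        omega
      · by_contra hc
        have hl : (build h i).length < i := by simpa using hc
        -- As long as the values are defined, every round appends exactly one entry.
        have key : ∀ k ≤ i, (build h k).length = k := by
          intro k
          induction k with
          | zero => simp [build]
          | succ k ihk =>
            intro hk
            have e := ihk (by omega)
            have hsome := hs k (by omega)
            rw [build, e]
            cases hk2 : h k with
            | none => simp [hk2] at hsome
            | some d => simp [e]
        exact hl.ne (key i le_rfl)

theorem build_mono {h h' : ℕ → Option ℕ} (H : ∀ i b, h i = some b → h' i = some b) {k k' : ℕ}
    (hk : k ≤ k') : build h k <+: build h' k' := by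
  have key : ∀ j < (build h k).length, ∃ b, h j = some b ∧ (build h k)[j]? = some b := by
    intro j hj
    have e := List.getElem?_eq_getElem hj
    exact ⟨_, build_getElem? e, e⟩
  refine List.prefix_iff_getElem?.2 fun i hi => ?_
  have hl : i < (build h' k').length := by
    refine lt_length_build (hi.trans_le ((length_build_le h k).trans hk)) fun j hj => ?_
    obtain ⟨b, hb, -⟩ := key j (hj.trans_lt hi)
    simp [H j b hb]
  obtain ⟨b, hb, hb'⟩ := key i hi
  have e := List.getElem?_eq_getElem hl
  have e' := build_getElem? e
  rw [H i b hb] at e'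
  rw [e, ← e', ← hb', List.getElem?_eq_getElem hi]

theorem build_eq_take {h : ℕ → Option ℕ} {r : Baire} (H : ∀ i b, h i = some b → r i = b) (k : ℕ) :
    build h k = take r (build h k).length := by
  refine List.ext_getElem? fun i => ?_
  rcases lt_or_ge i (build h k).length with hi | hi
  · have e := List.getElem?_eq_getElem hi
    rw [getElem?_take r hi, e, H i _ (build_getElem? e)]
  · rw [List.getElem?_eq_none hi, List.getElem?_eq_none (by simpa using hi)]

theorem computable_build {γ : Type} [Primcodable γ] {h : γ → ℕ → Option ℕ} {k : γ → ℕ}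
    (hh : Computable₂ h) (hk : Computable k) : Computable fun c => build (h c) (k c) := by
  have hstep : Computable₂ fun (c : γ) (x : ℕ × List ℕ) =>
      (Option.casesOn (h c x.2.length) x.2 fun b => x.2 ++ [b] : List ℕ) := by
    refine Computable.option_casesOn
      (hh.comp Computable.fst (Computable.list_length.comp (Computable.snd.comp Computable.snd)))
      (Computable.snd.comp Computable.snd) ?_
    exact Computable.list_concat.comp
      (Computable.snd.comp (Computable.snd.comp Computable.fst)) Computable.snd
  refine (Computable.nat_rec hk (Computable.const []) hstep).of_eq fun c => ?_
  induction k c with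
  | zero => rfl
  | succ n ih =>
    rw [build]
    simp only [ih]
    cases h c (build (h c) n).length <;> rfl

/-! ### Effective functionals -/

/-- Monotonicity lets finitely many prefixes be replaced by the longest one. -/
theorem exists_take_forall {α β : Type} {g : List ℕ → α → Option β}
    (hg : ∀ v w a b, v <+: w → g v a = some b → g w a = some b) {p : Baire} {a : ℕ → α}
    {b : ℕ → β} {m : ℕ} (h : ∀ k < m, ∃ n, g (take p n) (a k) = some (b k)) :
    ∃ n, ∀ k < m, g (take p n) (a k) = some (b k) := by
  induction m with
  | zero => exact ⟨0, fun k hk => absurd hk (Nat.not_lt_zero k)⟩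
  | succ m ih =>
    obtain ⟨n, hn⟩ := ih fun k hk => h k (by omega)
    obtain ⟨n', hn'⟩ := h m (Nat.lt_succ_self m)
    refine ⟨max n n', fun k hk => ?_⟩
    rcases Nat.lt_succ_iff_lt_or_eq.1 hk with hk | rfl
    · exact hg _ _ _ _ (take_prefix_take p (le_max_left n n')) (hn k hk)
    · exact hg _ _ _ _ (take_prefix_take p (le_max_right n n')) hn'

/-- Two prefixes of one point are comparable, so their answers both persist to the longer one. -/
theorem approx_unique {α β : Type} {g : List ℕ → α → Option β}
    (hg : ∀ v w a b, v <+: w → g v a = some b → g w a = some b) {p : Baire} {a : α} {m m' : ℕ}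
    {b b' : β} (h : g (take p m) a = some b) (h' : g (take p m') a = some b') : b = b' := by
  have e := hg _ _ _ _ (take_prefix_take p (le_max_left m m')) h
  have e' := hg _ _ _ _ (take_prefix_take p (le_max_right m m')) h'
  simpa [e] using e'

section Effective

variable {α β γ δ : Type} [Primcodable α] [Primcodable β] [Primcodable γ] [Primcodable δ]

/-- The relation `R p a b` between an oracle `p`, an input `a` and an output `b` is effective if
`b` can be computed from `a` and a sufficiently long prefix of `p`. -/
def EffectiveRel (R : Baire → α → β → Prop) : Prop :=
  ∃ g : List ℕ → α → Option β, Computable₂ g ∧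
    (∀ v w a b, v <+: w → g v a = some b → g w a = some b) ∧
    ∀ p a b, R p a b → ∃ n, g (take p n) a = some b

/-- A total functional that is effective. -/
def Effective (f : Baire → α → β) : Prop := EffectiveRel fun p a b => f p a = b

/-- A relation on Baire space is computable if its values can be computed from a name of the
argument. Such relations are single-valued, and they are the restrictions of the graphs of
computable partial functions. -/
def ComputableRel (R : Baire → Baire → Prop) : Prop :=
  EffectiveRel fun p n b => ∃ r, R p r ∧ r n = b

/-- A total computable function on Baire space. -/
def ComputableMap (f : Baire → Baire) : Prop := Effective f

theorem EffectiveRel.mono {R S : Baire → α → β → Prop} (hS : EffectiveRel S)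
    (h : ∀ p a b, R p a b → S p a b) : EffectiveRel R := by
  obtain ⟨g, h1, h2, h3⟩ := hS
  exact ⟨g, h1, h2, fun p a b hr => h3 p a b (h p a b hr)⟩

theorem Effective.of_eq {f g : Baire → α → β} (hf : Effective f) (h : ∀ p a, f p a = g p a) :
    Effective g :=
  EffectiveRel.mono hf fun p a _ hb => (h p a).trans hb

theorem Effective.of_computable {f : α → β} (hf : Computable f) :
    Effective fun _ a => f a :=
  ⟨fun _ a => some (f a), (Computable.option_some.comp (hf.comp Computable.snd)).to₂,
    fun _ _ _ _ _ h => h, fun _ _ _ h => ⟨0, by rw [← h]⟩⟩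

theorem Effective.oracle : Effective fun (p : Baire) (n : ℕ) => p n :=
  ⟨fun w n => w[n]?, Computable.list_getElem?, fun v w n _ h hb => by
      rw [List.getElem?_eq_some_iff] at hb
      obtain ⟨hn, rfl⟩ := hb
      exact List.prefix_iff_getElem?.1 h n hn,
    fun p n b h => ⟨n + 1, (getElem?_take p (Nat.lt_succ_self n)).trans (congrArg some h)⟩⟩

theorem EffectiveRel.comp {S : Baire → β → γ → Prop} {R : Baire → α → β → Prop}
    (hS : EffectiveRel S) (hR : EffectiveRel R) :
    EffectiveRel fun p a c => ∃ b, R p a b ∧ S p b c := by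
  obtain ⟨g, g1, g2, g3⟩ := hS
  obtain ⟨f, f1, f2, f3⟩ := hR
  refine ⟨fun w a => (f w a).bind (g w), ?_, ?_, ?_⟩
  · exact Computable.option_bind f1 (g1.comp (Computable.fst.comp Computable.fst) Computable.snd)
  · intro v w a c h hc
    rw [Option.bind_eq_some_iff] at hc ⊢
    obtain ⟨b, hb, hc⟩ := hc
    exact ⟨b, f2 v w a b h hb, g2 v w b c h hc⟩
  · rintro p a c ⟨b, hb, hc⟩
    obtain ⟨m, hm⟩ := f3 p a b hb
    obtain ⟨n, hn⟩ := g3 p b c hc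
    refine ⟨max m n, Option.bind_eq_some_iff.2 ⟨b, ?_, ?_⟩⟩
    · exact f2 _ _ _ _ (take_prefix_take p (le_max_left m n)) hm
    · exact g2 _ _ _ _ (take_prefix_take p (le_max_right m n)) hn

theorem EffectiveRel.comp_fun {S : Baire → β → γ → Prop} {f : Baire → α → β}
    (hS : EffectiveRel S) (hf : Effective f) : EffectiveRel fun p a c => S p (f p a) c :=
  (hS.comp hf).mono fun _ _ _ h => ⟨_, rfl, h⟩

theorem Effective.comp {g : Baire → β → γ} {f : Baire → α → β}
    (hg : Effective g) (hf : Effective f) : Effective fun p a => g p (f p a) :=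
  EffectiveRel.comp_fun (S := fun p b c => g p b = c) hg hf

theorem Effective.computable_comp {g : β → γ} {f : Baire → α → β}
    (hg : Computable g) (hf : Effective f) : Effective fun p a => g (f p a) :=
  (Effective.of_computable hg).comp hf

theorem Effective.comp_computable {g : Baire → β → γ} {f : α → β}
    (hg : Effective g) (hf : Computable f) : Effective fun p a => g p (f a) :=
  hg.comp (Effective.of_computable hf)

theorem Effective.pair {f : Baire → α → β} {g : Baire → α → γ} (hf : Effective f)
    (hg : Effective g) : Effective fun p a => (f p a, g p a) := by
  obtain ⟨g, g1, g2, g3⟩ := hg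
  obtain ⟨f, f1, f2, f3⟩ := hf
  refine ⟨fun w a => (f w a).bind fun b => (g w a).map fun c => (b, c), ?_, ?_, ?_⟩
  · refine Computable.option_bind f1 ?_
    refine Computable.option_map (g1.comp (Computable.fst.comp Computable.fst)
      (Computable.snd.comp Computable.fst)) ?_
    exact Computable.pair (Computable.snd.comp Computable.fst) Computable.snd
  · intro v w a c h hc
    simp only [Option.bind_eq_some_iff, Option.map_eq_some_iff] at hc ⊢
    obtain ⟨b, hb, c, hc, rfl⟩ := hc
    exact ⟨b, f2 v w a b h hb, c, g2 v w a c h hc, rfl⟩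
  · rintro p a _ rfl
    obtain ⟨m, hm⟩ := f3 p a _ rfl
    obtain ⟨n, hn⟩ := g3 p a _ rfl
    refine ⟨max m n, ?_⟩
    simp only [Option.bind_eq_some_iff, Option.map_eq_some_iff]
    exact ⟨_, f2 _ _ _ _ (take_prefix_take p (le_max_left m n)) hm, _,
      g2 _ _ _ _ (take_prefix_take p (le_max_right m n)) hn, rfl⟩

theorem Effective.computable₂_comp {h : β → γ → δ} {f : Baire → α → β} {g : Baire → α → γ}
    (hh : Computable₂ h) (hf : Effective f) (hg : Effective g) :
    Effective fun p a => h (f p a) (g p a) :=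
  (Effective.of_computable hh).comp (hf.pair hg)

theorem EffectiveRel.ite {c : Baire → α → Bool} {R S : Baire → α → β → Prop} (hc : Effective c)
    (hR : EffectiveRel R) (hS : EffectiveRel S) :
    EffectiveRel fun p a b => if c p a then R p a b else S p a b := by
  obtain ⟨k, k1, k2, k3⟩ := hc
  obtain ⟨g, g1, g2, g3⟩ := hS
  obtain ⟨f, f1, f2, f3⟩ := hR
  refine ⟨fun w a => (k w a).bind fun t => cond t (f w a) (g w a), ?_, ?_, ?_⟩
  · refine Computable.option_bind k1 ?_
    exact Computable.cond Computable.snd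
      (f1.comp (Computable.fst.comp Computable.fst) (Computable.snd.comp Computable.fst))
      (g1.comp (Computable.fst.comp Computable.fst) (Computable.snd.comp Computable.fst))
  · intro v w a c h hb
    rw [Option.bind_eq_some_iff] at hb ⊢
    obtain ⟨t, ht, hb⟩ := hb
    refine ⟨t, k2 v w a t h ht, ?_⟩
    cases t
    · exact g2 v w a c h hb
    · exact f2 v w a c h hb
  · intro p a b hb
    obtain ⟨m, hm⟩ := k3 p a _ rfl
    cases hcp : c p a
    · rw [hcp] at hb hm
      obtain ⟨n, hn⟩ := g3 p a b (by simpa using hb)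
      exact ⟨max m n, Option.bind_eq_some_iff.2 ⟨_,
        k2 _ _ _ _ (take_prefix_take p (le_max_left m n)) hm,
        g2 _ _ _ _ (take_prefix_take p (le_max_right m n)) hn⟩⟩
    · rw [hcp] at hb hm
      obtain ⟨n, hn⟩ := f3 p a b (by simpa using hb)
      exact ⟨max m n, Option.bind_eq_some_iff.2 ⟨_,
        k2 _ _ _ _ (take_prefix_take p (le_max_left m n)) hm,
        f2 _ _ _ _ (take_prefix_take p (le_max_right m n)) hn⟩⟩

theorem Effective.ite {c : Baire → α → Bool} {f g : Baire → α → β} (hc : Effective c)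
    (hf : Effective f) (hg : Effective g) :
    Effective fun p a => if c p a then f p a else g p a :=
  (EffectiveRel.ite hc hf hg).mono fun p a b h => by
    cases hcp : c p a <;> simpa [hcp] using h

/-- The recursion runs in `Option` on one fixed prefix; prefixes that suffice for the single steps
are merged by monotonicity. -/
theorem Effective.nat_rec {f : Baire → α → β} {h : Baire → α × ℕ × β → β} (hf : Effective f)
    (hh : Effective h) :
    Effective fun p (x : α × ℕ) =>
      (Nat.rec (f p x.1) (fun n b => h p (x.1, n, b)) x.2 : β) := by
  obtain ⟨g, g1, g2, g3⟩ := hh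
  obtain ⟨f', f1, f2, f3⟩ := hf
  refine ⟨fun w x => (Nat.rec (f' w x.1) (fun n o => o.bind fun b => g w (x.1, n, b)) x.2 :
    Option β), ?_, ?_, ?_⟩
  · refine Computable.nat_rec
      (h := fun (y : List ℕ × α × ℕ) (z : ℕ × Option β) => z.2.bind fun b => g y.1 (y.2.1, z.1, b))
      (Computable.snd.comp Computable.snd)
      (f1.comp Computable.fst (Computable.fst.comp Computable.snd)) ?_
    refine Computable.option_bind (Computable.snd.comp Computable.snd) ?_
    refine g1.comp (Computable.fst.comp (Computable.fst.comp Computable.fst)) ?_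
    exact Computable.pair
      (Computable.fst.comp (Computable.snd.comp (Computable.fst.comp Computable.fst)))
      (Computable.pair (Computable.fst.comp (Computable.snd.comp Computable.fst)) Computable.snd)
  · rintro v w ⟨a, n⟩ b hvw hb
    induction n generalizing b with
    | zero => exact f2 v w a b hvw hb
    | succ n ih =>
      simp only [Option.bind_eq_some_iff] at hb ⊢
      obtain ⟨c, hc, hb⟩ := hb
      exact ⟨c, ih c hc, g2 _ _ _ _ hvw hb⟩
  · rintro p ⟨a, n⟩ b rfl
    have mono : ∀ n b m m', m ≤ m' →
        (Nat.rec (f' (take p m) a) (fun n o => o.bind fun b => g (take p m) (a, n, b)) n :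
          Option β) = some b →
        (Nat.rec (f' (take p m') a) (fun n o => o.bind fun b => g (take p m') (a, n, b)) n :
          Option β) = some b := by
      intro n b m m' hm hb
      induction n generalizing b with
      | zero => exact f2 _ _ a b (take_prefix_take p hm) hb
      | succ n ih =>
        simp only [Option.bind_eq_some_iff] at hb ⊢
        obtain ⟨c, hc, hb⟩ := hb
        exact ⟨c, ih c hc, g2 _ _ _ _ (take_prefix_take p hm) hb⟩
    induction n with
    | zero => exact f3 p a _ rfl
    | succ n ih =>
      obtain ⟨m, hm⟩ := ih
      obtain ⟨m', hm'⟩ := g3 p (a, n, Nat.rec (f p a) (fun n b => h p (a, n, b)) n) _ rfl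
      refine ⟨max m m', ?_⟩
      simp only [Option.bind_eq_some_iff]
      exact ⟨_, mono n _ m _ (le_max_left m m') hm,
        g2 _ _ _ _ (take_prefix_take p (le_max_right m m')) hm'⟩

/-- Keeps the input next to the output, so that a computation following a search can still use both.
-/
theorem EffectiveRel.graph {R : Baire → α → β → Prop} (hR : EffectiveRel R) :
    EffectiveRel fun p a (y : α × β) => a = y.1 ∧ R p a y.2 := by
  obtain ⟨g, g1, g2, g3⟩ := hR
  refine ⟨fun w a => (g w a).map fun b => (a, b), ?_, ?_, ?_⟩
  · exact Computable.option_map g1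
      (Computable.pair (Computable.snd.comp Computable.fst) Computable.snd)
  · intro v w a y h hy
    rw [Option.map_eq_some_iff] at hy ⊢
    obtain ⟨b, hb, rfl⟩ := hy
    exact ⟨b, g2 v w a b h hb, rfl⟩
  · rintro p a ⟨_, b⟩ ⟨rfl, h⟩
    obtain ⟨m, hm⟩ := g3 p a b h
    exact ⟨m, by simp [hm]⟩

/-- Unbounded search. -/
theorem Effective.find {c : Baire → α × ℕ → Bool} (hc : Effective c) :
    EffectiveRel fun p a m => c p (a, m) = true ∧ ∀ k < m, c p (a, k) = false := by
  obtain ⟨g, g1, g2, g3⟩ := hc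
  -- The candidate after `n` rounds: a negative answer moves it on, a positive or missing answer
  -- keeps it.
  let s : List ℕ → α → ℕ → ℕ := fun w a n =>
    Nat.rec 0 (fun _ m => Option.casesOn (g w (a, m)) m fun t => cond t m (m + 1)) n
  have s_succ : ∀ w a n, s w a (n + 1) =
      Option.casesOn (g w (a, s w a n)) (s w a n) fun t => cond t (s w a n) (s w a n + 1) :=
    fun w a n => rfl
  have s_comp : Computable fun x : List ℕ × α => s x.1 x.2 x.1.length := by
    refine Computable.nat_rec
      (h := fun (y : List ℕ × α) (z : ℕ × ℕ) =>
        Option.casesOn (g y.1 (y.2, z.2)) z.2 fun t => cond t z.2 (z.2 + 1))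
      (Computable.list_length.comp Computable.fst) (Computable.const 0) ?_
    refine Computable.option_casesOn (g1.comp (Computable.fst.comp Computable.fst)
      (Computable.pair (Computable.snd.comp Computable.fst)
        (Computable.snd.comp Computable.snd))) (Computable.snd.comp Computable.snd) ?_
    exact Computable.cond Computable.snd
      (Computable.snd.comp (Computable.snd.comp Computable.fst))
      (Computable.succ.comp (Computable.snd.comp (Computable.snd.comp Computable.fst)))
  have below : ∀ w a n, ∀ k < s w a n, g w (a, k) = some false := by
    intro w a n
    induction n with
    | zero => intro k hk; exact absurd hk (Nat.not_lt_zero k)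
    | succ n ih =>
      intro k hk
      rw [s_succ] at hk
      cases ht : g w (a, s w a n) with
      | none => rw [ht] at hk; exact ih k hk
      | some t =>
        rw [ht] at hk
        cases t with
        | true => exact ih k hk
        | false =>
          rcases Nat.lt_succ_iff_lt_or_eq.1 hk with hk | rfl
          · exact ih k hk
          · exact ht
  have reach : ∀ w a m, (∀ k < m, g w (a, k) = some false) → g w (a, m) = some true →
      ∀ n, m ≤ n → s w a n = m := by
    intro w a m h1 h2 n hn
    have climb : ∀ n ≤ m, s w a n = n := by
      intro n
      induction n with
      | zero => intro _; rfl
      | succ n ih =>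
        intro hn
        rw [s_succ, ih (by omega), h1 n (by omega)]
        rfl
    induction n, hn using Nat.le_induction with
    | base => exact climb m le_rfl
    | succ n hn ih =>
      rw [s_succ, ih, h2]
      rfl
  refine ⟨fun w a => (g w (a, s w a w.length)).bind fun t =>
    cond t (some (s w a w.length)) none, ?_, ?_, ?_⟩
  · refine Computable.option_bind (g1.comp Computable.fst
      (Computable.pair Computable.snd s_comp)) ?_
    exact Computable.cond Computable.snd
      (Computable.option_some.comp (s_comp.comp Computable.fst)) (Computable.const none)
  · intro v w a b h hb
    rw [Option.bind_eq_some_iff] at hb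
    obtain ⟨t, ht, hb⟩ := hb
    cases t with
    | false => cases hb
    | true =>
      simp only [cond_true, Option.some.injEq] at hb
      -- The candidate grows by at most one per round, so the rounds allowed by the longer word `w`
      -- suffice to reach the same candidate.
      have hs : s v a v.length ≤ v.length := by
        generalize v.length = n
        induction n with
        | zero => exact le_rfl
        | succ n ih =>
          rw [s_succ]
          cases g v (a, s v a n) with
          | none => exact ih.trans (Nat.le_succ n)
          | some t =>
            cases t
            · exact Nat.succ_le_succ ih
            · exact ih.trans (Nat.le_succ n)
      have e : s w a w.length = s v a v.length :=
        reach w a _ (fun k hk => g2 v w _ _ h (below v a _ k hk)) (g2 v w _ _ h ht) _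
          (hs.trans h.length_le)
      beta_reduce
      rw [e, g2 v w _ _ h ht, Option.bind_some, cond_true, hb]
  · rintro p a m ⟨h1, h2⟩
    obtain ⟨n, hn⟩ := exists_take_forall g2 (m := m + 1) fun k _ => g3 p (a, k) _ rfl
    have hn' : ∀ k < m + 1, g (take p (max n m)) (a, k) = some (c p (a, k)) := fun k hk =>
      g2 _ _ _ _ (take_prefix_take p (le_max_left n m)) (hn k hk)
    have e : s (take p (max n m)) a (take p (max n m)).length = m := by
      refine reach _ a m (fun k hk => ?_) ?_ _ (by simp)
      · rw [hn' k (by omega), h2 k hk]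
      · rw [hn' m (by omega), h1]
    refine ⟨max n m, ?_⟩
    simp only [e, hn' m (Nat.lt_succ_self m), h1, Option.bind_some, cond_true]

/-- Substitution of a computed oracle. -/
theorem EffectiveRel.subst {R : Baire → α → β → Prop} {S : Baire → α × ℕ → ℕ → Prop}
    (hR : EffectiveRel R) (hS : EffectiveRel S) :
    EffectiveRel fun p a b => ∃ q : Baire, (∀ n, S p (a, n) (q n)) ∧ R q a b := by
  obtain ⟨f, f1, f2, f3⟩ := hR
  obtain ⟨g, g1, g2, g3⟩ := hS
  have hb : ∀ v w a, v <+: w →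
      build (fun n => g v (a, n)) v.length <+: build (fun n => g w (a, n)) w.length :=
    fun v w a h => build_mono (fun i b hb => g2 v w _ b h hb) h.length_le
  -- `f` is run on the part of the intermediate oracle that the prefix `w` already determines.
  refine ⟨fun w a => f (build (fun n => g w (a, n)) w.length) a, ?_, ?_, ?_⟩
  · refine f1.comp (computable_build (h := fun (x : List ℕ × α) n => g x.1 (x.2, n)) ?_
      (Computable.list_length.comp Computable.fst)) Computable.snd
    exact g1.comp (Computable.fst.comp Computable.fst)
      (Computable.pair (Computable.snd.comp Computable.fst) Computable.snd)
  · intro v w a b h hfb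
    exact f2 _ _ _ _ (hb v w a h) hfb
  · rintro p a b ⟨q, hq, hqb⟩
    obtain ⟨m, hm⟩ := f3 q a b hqb
    obtain ⟨n, hn⟩ := exists_take_forall g2 (m := m) fun k _ => g3 p (a, k) _ (hq k)
    refine ⟨max n m, f2 _ _ _ _ ?_ hm⟩
    refine List.prefix_iff_getElem?.2 fun i hi => ?_
    have hi' : i < m := by simpa using hi
    have hn' : ∀ k < m, g (take p (max n m)) (a, k) = some (q k) := fun k hk =>
      g2 _ _ _ _ (take_prefix_take p (le_max_left n m)) (hn k hk)
    have hl : i < (build (fun k => g (take p (max n m)) (a, k)) (take p (max n m)).length).length :=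
      lt_length_build (by rw [length_take]; omega) fun j hj => by simp [hn' j (by omega)]
    have e := List.getElem?_eq_getElem hl
    have e' := build_getElem? e
    simp only [hn' i hi'] at e'
    rw [e, ← e', ← List.getElem?_eq_getElem hi, getElem?_take q hi']

theorem EffectiveRel.subst_fun {R : Baire → α → β → Prop} {ψ : Baire → α → Baire}
    (hR : EffectiveRel R) (hψ : Effective fun p (x : α × ℕ) => ψ p x.1 x.2) :
    EffectiveRel fun p a b => R (ψ p a) a b :=
  (EffectiveRel.subst hR hψ).mono fun _ _ _ h => ⟨_, fun _ => rfl, h⟩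

theorem Effective.subst {φ : Baire → α → β} {ψ : Baire → α → Baire} (hφ : Effective φ)
    (hψ : Effective fun p (x : α × ℕ) => ψ p x.1 x.2) : Effective fun p a => φ (ψ p a) a :=
  EffectiveRel.subst_fun hφ hψ

theorem Effective.map {φ : Baire → α → β} {ψ : Baire → Baire} (hφ : Effective φ)
    (hψ : ComputableMap ψ) : Effective fun p a => φ (ψ p) a :=
  hφ.subst (Effective.comp_computable hψ Computable.snd)

end Effective

/-! ### Computable relations on Baire space -/

theorem ComputableRel.mono {R S : Baire → Baire → Prop} (hS : ComputableRel S)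
    (h : ∀ p r, R p r → S p r) : ComputableRel R :=
  EffectiveRel.mono hS fun _ _ _ ⟨r, hr, e⟩ => ⟨r, h _ _ hr, e⟩

/-- The function is defined wherever every digit eventually receives a value. Uniqueness of
approximated values identifies the chosen digits with those of `r`, and `build` turns digitwise
approximation into a monotone word function. -/
theorem ComputableRel.exists_fun {R : Baire → Baire → Prop} (hR : ComputableRel R) :
    ∃ F : Baire →. Baire, ComputableFun F ∧ ∀ p r, R p r → r ∈ F p := by
  obtain ⟨g, g1, g2, g3⟩ := hR
  refine ⟨fun p => ⟨∀ n, ∃ b m, g (take p m) n = some b, fun h n => (h n).choose⟩,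
    ⟨fun w => build (g w) w.length, ?_, ?_, ?_⟩, ?_⟩
  · exact computable_build g1 Computable.list_length
  · intro v w h
    exact build_mono (fun i b hb => g2 v w i b h hb) h.length_le
  · rintro p r ⟨hd, hr⟩
    have hrn : ∀ n, ∃ m, g (take p m) n = some (r n) := by
      intro n
      rw [← hr]
      exact (hd n).choose_spec
    refine ⟨fun n => build_eq_take (fun i b hb => ?_) _, fun m => ?_⟩
    · obtain ⟨m, hm⟩ := hrn i
      exact approx_unique g2 hm hb
    · obtain ⟨n, hn⟩ := exists_take_forall g2 (a := fun k => k) (m := m + 1) fun k _ => hrn k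
      refine ⟨max n (m + 1), (lt_length_build (i := m) (by rw [length_take]; omega) ?_).le⟩
      intro j hj
      rw [g2 _ _ _ _ (take_prefix_take p (le_max_left n (m + 1))) (hn j (by omega))]
      rfl
  · intro p r hr
    have hrn : ∀ n, ∃ m, g (take p m) n = some (r n) := fun n => g3 p n _ ⟨r, hr, rfl⟩
    refine ⟨fun n => ⟨r n, hrn n⟩, funext fun n => ?_⟩
    obtain ⟨m, hm⟩ := hrn n
    have hd : ∃ b m, g (take p m) n = some b := ⟨r n, hrn n⟩
    obtain ⟨m', hm'⟩ := hd.choose_spec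
    exact approx_unique g2 hm' hm

theorem ComputableFun.computableRel {F : Baire →. Baire} (hF : ComputableFun F) :
    ComputableRel fun p r => r ∈ F p := by
  obtain ⟨f, f1, f2, f3⟩ := hF
  refine ⟨fun w n => (f w)[n]?, ?_, ?_, ?_⟩
  · exact Computable.list_getElem?.comp (f1.comp Computable.fst) Computable.snd
  · intro v w n b h hb
    rw [List.getElem?_eq_some_iff] at hb
    obtain ⟨hn, rfl⟩ := hb
    exact List.prefix_iff_getElem?.1 (f2 v w h) n hn
  · rintro p n b ⟨r, hr, rfl⟩
    obtain ⟨h1, h2⟩ := f3 p r hr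
    obtain ⟨k, hk⟩ := h2 (n + 1)
    refine ⟨k, ?_⟩
    simp only
    rw [h1 k, getElem?_take r (by omega)]

theorem ComputableMap.computableRel {f : Baire → Baire} (hf : ComputableMap f) :
    ComputableRel fun p r => f p = r :=
  EffectiveRel.mono hf fun p n b ⟨r, hr, e⟩ => by
    have hr : f p = r := hr
    simpa [hr] using e

theorem ComputableRel.comp {S R : Baire → Baire → Prop} (hS : ComputableRel S)
    (hR : ComputableRel R) : ComputableRel fun p r => ∃ q, R p q ∧ S q r := by
  refine (EffectiveRel.subst hS (EffectiveRel.comp_fun hR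
    (Effective.of_computable (Computable.snd (α := ℕ) (β := ℕ))))).mono ?_
  rintro p n b ⟨r, ⟨q, hq, hr⟩, rfl⟩
  exact ⟨q, fun m => ⟨q, hq, rfl⟩, r, hr, rfl⟩

theorem ComputableRel.comp_map {S : Baire → Baire → Prop} {f : Baire → Baire}
    (hS : ComputableRel S) (hf : ComputableMap f) : ComputableRel fun p r => S (f p) r :=
  (hS.comp hf.computableRel).mono fun _ _ h => ⟨_, rfl, h⟩

theorem ComputableRel.map {R : Baire → Baire → Prop} {f : Baire → Baire}
    (hf : ComputableMap f) (hR : ComputableRel R) :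
    ComputableRel fun p r => ∃ q, R p q ∧ f q = r :=
  hf.computableRel.comp hR

theorem ComputableMap.comp {f g : Baire → Baire} (hf : ComputableMap f) (hg : ComputableMap g) :
    ComputableMap fun p => f (g p) :=
  Effective.map hf hg

theorem computableMap_id : ComputableMap fun p => p := Effective.oracle

theorem computable_mod_two : Computable fun n : ℕ => decide (n % 2 = 0) :=
  (Primrec.eq.decide.comp (Primrec.nat_mod.comp Primrec.id (Primrec.const 2))
    (Primrec.const 0)).to_comp

theorem computable_div_two : Computable fun n : ℕ => n / 2 :=
  (Primrec.nat_div.comp Primrec.id (Primrec.const 2)).to_comp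

theorem ComputableRel.pair {R S : Baire → Baire → Prop} (hR : ComputableRel R)
    (hS : ComputableRel S) : ComputableRel fun p z => R p (left z) ∧ S p (right z) := by
  have hdiv := Effective.of_computable computable_div_two
  refine (EffectiveRel.ite (Effective.of_computable computable_mod_two)
    (EffectiveRel.comp_fun hR hdiv) (EffectiveRel.comp_fun hS hdiv)).mono ?_
  rintro p n b ⟨z, ⟨h1, h2⟩, rfl⟩
  rcases Nat.mod_two_eq_zero_or_one n with h | h
  · simp only [h, decide_true, if_true]
    refine ⟨_, h1, ?_⟩
    rw [left]
    congr 1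
    omega
  · simp only [h, one_ne_zero, decide_false, Bool.false_eq_true, if_false]
    refine ⟨_, h2, ?_⟩
    rw [right]
    congr 1
    omega

theorem Effective.pair_seq {α : Type} [Primcodable α] {f g : Baire → α × ℕ → ℕ}
    (hf : Effective f) (hg : Effective g) :
    Effective fun p (x : α × ℕ) =>
      Weihrauch.pair (fun n => f p (x.1, n)) (fun n => g p (x.1, n)) x.2 := by
  have hdiv : Computable fun x : α × ℕ => (x.1, x.2 / 2) :=
    Computable.pair Computable.fst (computable_div_two.comp Computable.snd)
  refine ((Effective.of_computable (computable_mod_two.comp Computable.snd)).ite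
    (hf.comp_computable hdiv) (hg.comp_computable hdiv)).of_eq fun p x => ?_
  simp [Weihrauch.pair]

theorem ComputableMap.pair {f g : Baire → Baire} (hf : ComputableMap f) (hg : ComputableMap g) :
    ComputableMap fun p => Weihrauch.pair (f p) (g p) :=
  ((Effective.of_computable computable_mod_two).ite
    (Effective.comp_computable hf computable_div_two)
    (Effective.comp_computable hg computable_div_two)).of_eq fun p n => by simp [Weihrauch.pair]

theorem computableMap_left : ComputableMap left :=
  Effective.of_eq (Effective.comp_computable Effective.oracle
    (Primrec.nat_mul.comp (Primrec.const 2) Primrec.id).to_comp) fun _ _ => rfl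

theorem computableMap_right : ComputableMap right :=
  Effective.of_eq (Effective.comp_computable Effective.oracle
    (Primrec.succ.comp (Primrec.nat_mul.comp (Primrec.const 2) Primrec.id)).to_comp) fun _ _ => rfl

theorem ComputableMap.left {f : Baire → Baire} (hf : ComputableMap f) :
    ComputableMap fun p => left (f p) :=
  computableMap_left.comp hf

theorem ComputableMap.right {f : Baire → Baire} (hf : ComputableMap f) :
    ComputableMap fun p => right (f p) :=
  computableMap_right.comp hf

/-- Applying a computable relation to all members of a computable sequence of points. -/
theorem ComputableRel.tuple {R : Baire → Baire → Prop} {s : Baire → ℕ → Baire}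
    (hR : ComputableRel R) (hs : Effective fun p (x : ℕ × ℕ) => s p x.1 x.2) :
    ComputableRel fun p z => ∀ i, R (s p i) (component z i) := by
  have h1 : EffectiveRel fun (p : Baire) (x : ℕ × ℕ) b => ∃ r, R (s p x.1) r ∧ r x.2 = b :=
    EffectiveRel.subst_fun (ψ := fun p x => s p x.1)
      (EffectiveRel.comp_fun hR (Effective.of_computable Computable.snd))
      (hs.comp_computable (Computable.pair (Computable.fst.comp Computable.fst) Computable.snd))
  refine (EffectiveRel.comp_fun h1 (Effective.of_computable Computable.unpair)).mono ?_
  rintro p n b ⟨z, hz, rfl⟩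
  refine ⟨_, hz _, ?_⟩
  simp [component]

theorem effective_component {α : Type} [Primcodable α] {i j : α → ℕ} (hi : Computable i)
    (hj : Computable j) : Effective fun p a => component p (i a) (j a) :=
  Effective.comp_computable Effective.oracle (Primrec₂.natPair.to_comp.comp hi hj)

theorem ComputableMap.tuple {s : Baire → ℕ → Baire}
    (hs : Effective fun p (x : ℕ × ℕ) => s p x.1 x.2) :
    ComputableMap fun p => tuple (s p) :=
  Effective.of_eq (Effective.comp_computable hs Computable.unpair) fun _ _ => rfl

open Encodable Denumerable

/-! ### The universal function is computable -/

theorem Effective.take {f : Baire → Baire} (hf : ComputableMap f) :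
    Effective fun p n => take (f p) n := by
  have h : Effective fun p (x : ℕ × ℕ × List ℕ) => x.2.2 ++ [f p x.2.1] :=
    Effective.computable₂_comp (h := fun (l : List ℕ) (b : ℕ) => l ++ [b]) Computable.list_concat
      (Effective.of_computable (Computable.snd.comp Computable.snd))
      (Effective.comp_computable hf (Computable.fst.comp Computable.snd))
  refine ((Effective.nat_rec (f := fun _ _ => []) (Effective.of_computable (Computable.const []))
    h).comp_computable (Computable.pair (Computable.const 0) Computable.id)).of_eq fun p n => ?_
  simp only [id]
  induction n with
  | zero => rfl
  | succ n ih => simp [ih, Weihrauch.take, List.range_succ]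

/-- Decoding never fails in a denumerable type, so the default value is irrelevant. -/
theorem primrec_ofNat_prod : Primrec fun n => ofNat (List ℕ × List ℕ) n :=
  (Primrec.option_getD.comp (Primrec.decode (α := List ℕ × List ℕ))
    (Primrec.const ([], []))).of_eq fun n => by
      rw [show (decode n : Option (List ℕ × List ℕ)) = some (ofNat _ n) from decode_eq_ofNat _ n]
      rfl

theorem primrec_ofNat_natList : Primrec fun n => ofNat (ℕ × List ℕ) n :=
  (Primrec.option_getD.comp (Primrec.decode (α := ℕ × List ℕ))
    (Primrec.const (0, []))).of_eq fun n => by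
      rw [show (decode n : Option (ℕ × List ℕ)) = some (ofNat _ n) from decode_eq_ofNat _ n]
      rfl

theorem primrec_ofNat_list : Primrec fun n => ofNat (List ℕ) n :=
  (Primrec.option_getD.comp (Primrec.decode (α := List ℕ)) (Primrec.const [])).of_eq fun n => by
      rw [show (decode n : Option (List ℕ)) = some (ofNat _ n) from decode_eq_ofNat _ n]
      rfl

/-- The prefix of the input to compare with is a separate argument `y.2`. This makes the step a
function of finite objects; `effective_phiStep` then supplies the prefix of the right length. -/
theorem primrec_phiStep : Primrec fun y : (ℕ × List ℕ) × List ℕ =>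
    if y.1.1 < 3 then y.1.2
    else if (ofNat (List ℕ × List ℕ) (y.1.1 - 3)).1 = y.2 ∧
        y.1.2 <+: (ofNat (List ℕ × List ℕ) (y.1.1 - 3)).2 then
      (ofNat (List ℕ × List ℕ) (y.1.1 - 3)).2
    else y.1.2 := by
  have hd : Primrec fun y : (ℕ × List ℕ) × List ℕ => y.1.1 := Primrec.fst.comp Primrec.fst
  have hv : Primrec fun y : (ℕ × List ℕ) × List ℕ => y.1.2 := Primrec.snd.comp Primrec.fst
  have he : Primrec fun y : (ℕ × List ℕ) × List ℕ => ofNat (List ℕ × List ℕ) (y.1.1 - 3) :=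
    primrec_ofNat_prod.comp (Primrec.nat_sub.comp hd (Primrec.const 3))
  have hpre : PrimrecPred fun y : (ℕ × List ℕ) × List ℕ =>
      y.1.2 <+: (ofNat (List ℕ × List ℕ) (y.1.1 - 3)).2 :=
    (Primrec.eq.comp hv (Primrec.list_take.comp (Primrec.list_length.comp hv)
      (Primrec.snd.comp he))).of_eq fun y => List.prefix_iff_eq_take.symm
  exact Primrec.ite (Primrec.nat_lt.comp hd (Primrec.const 3)) hv
    (Primrec.ite ((Primrec.eq.comp (Primrec.fst.comp he) Primrec.snd).and hpre)
      (Primrec.snd.comp he) hv)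

theorem effective_phiStep : Effective fun (p : Baire) (x : ℕ × ℕ × List ℕ) =>
    phiStep (right p) x.2.2 (left p x.2.1) := by
  have hd : Effective fun (p : Baire) (x : ℕ × ℕ × List ℕ) => left p x.2.1 :=
    Effective.comp_computable computableMap_left (Computable.fst.comp Computable.snd)
  have hv : Effective fun (_ : Baire) (x : ℕ × ℕ × List ℕ) => x.2.2 :=
    Effective.of_computable (Computable.snd.comp Computable.snd)
  have hlen : Effective fun (p : Baire) (x : ℕ × ℕ × List ℕ) =>
      (ofNat (List ℕ × List ℕ) (left p x.2.1 - 3)).1.length :=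
    Effective.computable_comp
      (g := fun d => (ofNat (List ℕ × List ℕ) (d - 3)).1.length)
      (Primrec.list_length.comp (Primrec.fst.comp
        (primrec_ofNat_prod.comp (Primrec.nat_sub.comp Primrec.id (Primrec.const 3))))).to_comp hd
  exact Effective.computable_comp primrec_phiStep.to_comp
    ((hd.pair hv).pair ((Effective.take computableMap_right).comp hlen))

theorem effective_phiRun : Effective fun x k => phiRun (left x) (right x) k := by
  refine ((Effective.nat_rec (f := fun _ _ => []) (Effective.of_computable (Computable.const []))
    effective_phiStep).comp_computable (Computable.pair (Computable.const 0) Computable.id)).of_eq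
    fun p n => ?_
  simp only [id]
  induction n with
  | zero => rfl
  | succ n ih => simp only [ih, phiRun]

/-- Digit `n` is found by searching for the first stage whose output is longer than `n`, the same
stage that `Phi` selects by `Nat.find`. On the domain the default `0` is never returned. -/
theorem computableRel_univ : ComputableRel fun x z => z ∈ univ x := by
  have hlt : Effective fun (p : Baire) (x : ℕ × ℕ) =>
      decide (x.1 < (phiRun (left p) (right p) x.2).length) :=
    Effective.computable₂_comp (h := fun a b : ℕ => decide (a < b)) Primrec.nat_lt.decide.to_comp
      (Effective.of_computable Computable.fst)
      (Effective.computable_comp Computable.list_length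
        (effective_phiRun.comp_computable Computable.snd))
  have hget : Effective fun (p : Baire) (x : ℕ × ℕ) =>
      ((phiRun (left p) (right p) x.2)[x.1]?).getD 0 := by
    refine Effective.computable_comp (g := fun o : Option ℕ => o.getD 0)
      (Computable.option_getD Computable.id (Computable.const 0)) ?_
    exact Effective.computable₂_comp (h := fun (l : List ℕ) (i : ℕ) => l[i]?)
      Computable.list_getElem?
      (effective_phiRun.comp_computable Computable.snd) (Effective.of_computable Computable.fst)
  refine (EffectiveRel.comp hget (Effective.find hlt).graph).mono ?_
  rintro x n b ⟨z, ⟨hd, rfl⟩, rfl⟩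
  refine ⟨(n, Nat.find (hd n)), ⟨rfl, by simpa using Nat.find_spec (hd n),
    fun k hk => by simpa using Nat.find_min (hd n) hk⟩, ?_⟩
  simp only
  rw [List.getElem?_eq_getElem (Nat.find_spec (hd n))]
  rfl

/-! ### Names of functions -/

/-- A criterion for `Φ_q(p) = z`: the pairs in the name `q` that apply to `p` have right-hand
sides that are prefixes of `z`, and they are arbitrarily long. -/
theorem mem_Phi {q p z : Baire}
    (sound : ∀ k, 3 ≤ q k →
      (ofNat (List ℕ × List ℕ) (q k - 3)).1 =
        take p (ofNat (List ℕ × List ℕ) (q k - 3)).1.length →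
      (ofNat (List ℕ × List ℕ) (q k - 3)).2 =
        take z (ofNat (List ℕ × List ℕ) (q k - 3)).2.length)
    (complete : ∀ n, ∃ k, 3 ≤ q k ∧
      (ofNat (List ℕ × List ℕ) (q k - 3)).1 =
        take p (ofNat (List ℕ × List ℕ) (q k - 3)).1.length ∧
      n < (ofNat (List ℕ × List ℕ) (q k - 3)).2.length) :
    z ∈ Phi q p := by
  have inv : ∀ k, phiRun q p k = take z (phiRun q p k).length := by
    intro k
    induction k with
    | zero => rfl
    | succ k ih =>
      simp only [phiRun, phiStep]
      split_ifs with h1 h2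
      · exact ih
      · exact sound k (by omega) h2.1
      · exact ih
  have hd : ∀ n, ∃ k, n < (phiRun q p k).length := by
    intro n
    obtain ⟨k, h1, h2, h3⟩ := complete n
    refine ⟨k + 1, ?_⟩
    simp only [phiRun, phiStep]
    split_ifs with h4 h5
    · omega
    · exact h3
    -- A skipped pair would have to contradict the output so far. Both are prefixes of `z`, so the
    -- pair can only be skipped if the output is already longer.
    · by_contra hc
      exact h5 ⟨h2, prefix_of_length_le (inv k) (sound k h1 h2) (by omega)⟩
  refine ⟨hd, funext fun n => ?_⟩
  have hn := Nat.find_spec (hd n)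
  have e : (phiRun q p (Nat.find (hd n)))[n]? = some (z n) := by
    rw [inv, getElem?_take z hn]
  rw [List.getElem?_eq_getElem hn] at e
  exact Option.some.inj e

/-! ### Coding of states by dummy digits -/

/-- The sequence `x` coded with digits `0` and `1` only. -/
def graphCode (x : Baire) : Baire := fun n => if x n.unpair.1 = n.unpair.2 then 0 else 1

theorem graphCode_le_one (x : Baire) (n : ℕ) : graphCode x n ≤ 1 := by
  unfold graphCode
  split_ifs <;> omega

/-- Position `0` codes the pair `(0, 0)`. Hence the halting signal of the diamond operator, a first
digit `0`, survives the coding. -/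
theorem graphCode_zero (x : Baire) : graphCode x 0 = 0 ↔ x 0 = 0 := by
  simp [graphCode]

theorem computableMap_graphCode : ComputableMap graphCode := by
  refine ((Effective.computable₂_comp (h := fun a b : ℕ => decide (a = b))
    Primrec.eq.decide.to_comp
    (Effective.comp_computable Effective.oracle (Computable.fst.comp Computable.unpair))
    (Effective.of_computable (Computable.snd.comp Computable.unpair))).ite
    (Effective.of_computable (Computable.const 0))
    (Effective.of_computable (Computable.const 1))).of_eq fun p n => ?_
  simp [graphCode]

/-- The digit `x n` is the only `b` for which the code has a `0` at position `⟨n, b⟩`, so a search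
finds it. -/
theorem computableRel_graphCode_symm : ComputableRel fun z x => graphCode x = z := by
  have h : Effective fun (z : Baire) (x : ℕ × ℕ) => decide (z (Nat.pair x.1 x.2) = 0) :=
    Effective.computable_comp (g := fun b : ℕ => decide (b = 0))
      (Primrec.eq.decide.comp Primrec.id (Primrec.const 0)).to_comp
      (Effective.comp_computable Effective.oracle
        (Primrec₂.natPair.comp Primrec.fst Primrec.snd).to_comp)
  refine (Effective.find h).mono ?_
  rintro z n b ⟨x, rfl, rfl⟩
  constructor
  · simp [graphCode]
  · intro k hk
    simp [graphCode, hk.ne']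

/-- The word that alternates between two words of the same length. -/
def zipWord (u w : List ℕ) : List ℕ :=
  (List.range (2 * w.length)).map fun i =>
    if i % 2 = 0 then u.getD (i / 2) 0 else w.getD (i / 2) 0

theorem primrec_zipWord : Primrec₂ zipWord := by
  refine Primrec.list_map (Primrec.list_range.comp (Primrec.nat_mul.comp (Primrec.const 2)
    (Primrec.list_length.comp Primrec.snd))) ?_
  have hdiv : Primrec fun x : (List ℕ × List ℕ) × ℕ => x.2 / 2 :=
    Primrec.nat_div.comp Primrec.snd (Primrec.const 2)
  refine Primrec.ite (Primrec.eq.comp (Primrec.nat_mod.comp Primrec.snd (Primrec.const 2))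
    (Primrec.const 0)) ?_ ?_
  · exact (Primrec.list_getD 0).comp (Primrec.fst.comp Primrec.fst) hdiv
  · exact (Primrec.list_getD 0).comp (Primrec.snd.comp Primrec.fst) hdiv

/-- Connects a word `w` on the answer side of a name with a prefix of the joint oracle `⟨x, r⟩`. -/
theorem zipWord_take (x r : Baire) (n : ℕ) :
    zipWord (take x n) (take r n) = take (pair x r) (2 * n) := by
  rw [zipWord, length_take]
  conv_rhs => rw [take]
  refine List.map_congr_left fun i hi => ?_
  have hi : i / 2 < n := by
    rw [List.mem_range] at hi
    omega
  simp only [pair, List.getD_eq_getElem?_getD, getElem?_take _ hi, Option.getD_some]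

/-! ### Iterating a computable step -/

open Nat.Partrec

/-- The name that lists the pairs `(w, v)` for which the program `c` returns `v` on the word that
alternates between `x` and `w`. -/
def programName (c : Code) (x : Baire) : Baire := fun n =>
  ((Code.evaln (ofNat (ℕ × List ℕ) n).1 c
      (encode (zipWord (take x (ofNat (ℕ × List ℕ) n).2.length) (ofNat (ℕ × List ℕ) n).2))).map
    fun v => encode ((ofNat (ℕ × List ℕ) n).2, ofNat (List ℕ) v) + 3).getD 0

/-- The uniformity in the code is what the recursion theorem in `exists_encoding` requires. -/
theorem effective_programName :
    Effective fun x (a : Code × ℕ) => programName a.1 x a.2 := by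
  have hk : Effective fun (_ : Baire) (a : Code × ℕ) => (ofNat (ℕ × List ℕ) a.2).1 :=
    Effective.of_computable (Computable.fst.comp
      (primrec_ofNat_natList.to_comp.comp Computable.snd))
  have hw' : Computable fun (a : Code × ℕ) => (ofNat (ℕ × List ℕ) a.2).2 :=
    Computable.snd.comp (primrec_ofNat_natList.to_comp.comp Computable.snd)
  have hw : Effective fun (_ : Baire) (a : Code × ℕ) => (ofNat (ℕ × List ℕ) a.2).2 :=
    Effective.of_computable hw'
  have hz : Effective fun (x : Baire) (a : Code × ℕ) =>
      encode (zipWord (take x (ofNat (ℕ × List ℕ) a.2).2.length) (ofNat (ℕ × List ℕ) a.2).2) :=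
    Effective.computable_comp Computable.encode
      (Effective.computable₂_comp primrec_zipWord.to_comp
        ((Effective.take computableMap_id).comp (Effective.computable_comp Computable.list_length
          hw)) hw)
  have hev : Effective fun (x : Baire) (a : Code × ℕ) =>
      Code.evaln (ofNat (ℕ × List ℕ) a.2).1 a.1 (encode
        (zipWord (take x (ofNat (ℕ × List ℕ) a.2).2.length) (ofNat (ℕ × List ℕ) a.2).2)) :=
    Effective.computable_comp (g := fun a : (ℕ × Code) × ℕ => Code.evaln a.1.1 a.1.2 a.2)
      Code.primrec_evaln.to_comp ((hk.pair (Effective.of_computable Computable.fst)).pair hz)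
  have hout : Computable₂ fun (w : List ℕ) (o : Option ℕ) =>
      (o.map fun v => encode (w, ofNat (List ℕ) v) + 3).getD 0 := by
    refine Computable.option_getD (Computable.option_map Computable.snd ?_) (Computable.const 0)
    have : Primrec fun y : (List ℕ × Option ℕ) × ℕ => encode (y.1.1, ofNat (List ℕ) y.2) + 3 :=
      Primrec.nat_add.comp (Primrec.encode.comp (Primrec.pair (Primrec.fst.comp Primrec.fst)
        (primrec_ofNat_list.comp Primrec.snd))) (Primrec.const 3)
    exact this.to_comp
  exact Effective.computable₂_comp (h := fun (w : List ℕ) (o : Option ℕ) =>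
    (o.map fun v => encode (w, ofNat (List ℕ) v) + 3).getD 0) hout hw hev

/-- The point with first component the name of a program with parameter `x`, which also codes `x`
with dummy symbols, and second component `b`. -/
def statePoint (c : Code) (b x : Baire) : Baire :=
  pair (pair (graphCode x) (programName c x)) b

theorem effective_statePoint {B : Baire → Baire} (hB : ComputableMap B) :
    Effective fun x (a : Code × ℕ) => statePoint a.1 (B x) x a.2 :=
  Effective.pair_seq
    (f := fun x a => pair (graphCode x) (programName a.1 x) a.2) (g := fun x a => B x a.2)
    (Effective.pair_seq (f := fun x a => graphCode x a.2)
      (Effective.comp_computable computableMap_graphCode Computable.snd) effective_programName)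
    (Effective.comp_computable hB Computable.snd)

/-- Every computable step `T` that consumes a value of some function at `B x` can be performed by
passes of the universal loop: states `x` are represented by points `E x`, from which `x` can be
recovered, and whose name components compute the next such point. -/
theorem exists_encoding {T : Baire → Baire → Prop} (hT : ComputableRel T) {B : Baire → Baire}
    (hB : ComputableMap B) :
    ∃ E : Baire → Baire, ComputableMap E ∧ (∀ x, right (E x) = B x) ∧
      (∀ x, left (left (E x)) = graphCode x) ∧
      ∀ x r y, T (pair x r) y → E y ∈ Phi (left (E x)) r := by
  -- From `p = ⟨x, r⟩` the point of the next state is computed, uniformly in a code `a.1` that is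
  -- still arbitrary.
  have hR : EffectiveRel fun p (a : Code × ℕ) b =>
      ∃ y, T p y ∧ statePoint a.1 (B y) y a.2 = b := by
    refine (EffectiveRel.subst (effective_statePoint hB) (EffectiveRel.comp_fun hT
      (Effective.of_computable (Computable.snd (α := Code × ℕ) (β := ℕ))))).mono ?_
    rintro p a b ⟨y, hy, rfl⟩
    exact ⟨y, fun n => ⟨y, hy, rfl⟩, rfl⟩
  obtain ⟨g, g1, g2, g3⟩ := hR
  let f : Code → List ℕ → List ℕ := fun c w => build (fun n => g w (c, n)) w.length
  have hf : Computable₂ f :=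
    computable_build (h := fun (x : Code × List ℕ) n => g x.2 (x.1, n))
      (g1.comp (Computable.snd.comp Computable.fst)
        (Computable.pair (Computable.fst.comp Computable.fst) Computable.snd))
      (Computable.list_length.comp Computable.snd)
  have hf' : Partrec₂ fun c n => Part.some (encode (f c (ofNat (List ℕ) n))) :=
    (Computable.encode.comp (hf.comp Computable.fst
      (primrec_ofNat_list.to_comp.comp Computable.snd))).partrec
  -- By the recursion theorem, `c` is a program for the word function that itself writes names built
  -- from `c`.
  obtain ⟨c, hc⟩ := Code.fixed_point₂ hf'
  refine ⟨fun x => statePoint c (B x) x,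
    (effective_statePoint hB).comp_computable (Computable.pair (Computable.const c) Computable.id),
    fun x => by simp [statePoint, right_pair], fun x => by simp [statePoint, left_pair], ?_⟩
  intro x r y hy
  have hev : ∀ k w v, Code.evaln k c (encode w) = some v → v = encode (f c w) := by
    intro k w v h
    have := Code.evaln_sound (Option.mem_def.2 h)
    rw [hc] at this
    simpa using this
  have hev' : ∀ w : List ℕ, ∃ k, Code.evaln k c (encode w) = some (encode (f c w)) := by
    intro w
    have : encode (f c w) ∈ Code.eval c (encode w) := by
      rw [hc]
      simp
    exact Code.evaln_complete.1 this
  have hval : ∀ i, ∃ m, g (take (pair x r) m) (c, i) = some (statePoint c (B y) y i) :=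
    fun i => g3 _ _ _ ⟨y, hy, rfl⟩
  have hsound : ∀ m, f c (take (pair x r) m) =
      take (statePoint c (B y) y) (f c (take (pair x r) m)).length := by
    intro m
    refine build_eq_take (fun i b hb => ?_) _
    obtain ⟨n, hn⟩ := hval i
    exact approx_unique g2 hn hb
  -- Only even lengths matter, since the name sees prefixes of `⟨x, r⟩` zipped from words of equal
  -- length.
  have hlong : ∀ n, ∃ m, n < (f c (take (pair x r) (2 * m))).length := by
    intro n
    obtain ⟨m, hm⟩ := exists_take_forall g2 (a := fun k => (c, k)) (m := n + 1) fun k _ => hval k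
    refine ⟨max m (n + 1), lt_length_build (by rw [length_take]; omega) fun j hj => ?_⟩
    rw [g2 _ _ _ _ (take_prefix_take _ (by omega)) (hm j (by omega))]
    rfl
  -- Even positions hold digits of `graphCode x`, which are dummies. An odd position is a dummy too,
  -- by the default `0`, unless the bounded evaluation has halted.
  have hdig : ∀ k, 3 ≤ pair (graphCode x) (programName c x) k →
      ∃ w, pair (graphCode x) (programName c x) k =
        encode (w, f c (zipWord (take x w.length) w)) + 3 := by
    intro k hk
    rcases Nat.mod_two_eq_zero_or_one k with h | h
    · have := graphCode_le_one x (k / 2)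
      simp only [pair, h, if_true] at hk
      omega
    · simp only [pair, h, one_ne_zero, if_false] at hk ⊢
      generalize k / 2 = n at hk ⊢
      refine ⟨(ofNat (ℕ × List ℕ) n).2, ?_⟩
      rw [programName] at hk ⊢
      cases hv : Code.evaln (ofNat (ℕ × List ℕ) n).1 c (encode (zipWord
          (take x (ofNat (ℕ × List ℕ) n).2.length) (ofNat (ℕ × List ℕ) n).2)) with
      | none =>
        rw [hv] at hk
        simp at hk
      | some v =>
        rw [hev _ _ _ hv]
        simp
  have hname : left (statePoint c (B x) x) = pair (graphCode x) (programName c x) := by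
    simp [statePoint, left_pair]
  rw [hname]
  refine mem_Phi ?_ ?_
  · intro k hk he
    obtain ⟨w, hw⟩ := hdig k hk
    rw [hw, Nat.add_sub_cancel, ofNat_encode] at he ⊢
    simp only at he ⊢
    rw [he, length_take, zipWord_take]
    exact hsound _
  · intro n
    obtain ⟨m, hm⟩ := hlong n
    obtain ⟨k, hk⟩ := hev' (take (pair x r) (2 * m))
    -- The program part sits at the odd positions, and its digit with index `(k, w)` treats the word
    -- `w` with evaluation bound `k`.
    refine ⟨2 * encode (k, take r m) + 1, ?_⟩
    have hw : pair (graphCode x) (programName c x) (2 * encode (k, take r m) + 1) =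
        encode (take r m, f c (take (pair x r) (2 * m))) + 3 := by
      have h1 : (2 * encode (k, take r m) + 1) % 2 = 1 := by omega
      have h2 : (2 * encode (k, take r m) + 1) / 2 = encode (k, take r m) := by omega
      simp only [pair, h1, h2, one_ne_zero, if_false]
      rw [programName, ofNat_encode]
      simp only [length_take]
      rw [zipWord_take, hk]
      simp
    rw [hw, Nat.add_sub_cancel, ofNat_encode]
    simpa using hm

namespace Problem

/-! ### Strong reductions -/

/-- Removes realizers from the later arguments: it suffices to control every solution of the
instance `y`, since a realizer returns one of them. -/
theorem StrongWeihrauchLE.of_computableRel {f g : Problem} {H K : Baire → Baire → Prop}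
    (hH : ComputableRel H) (hK : ComputableRel K)
    (h : ∀ p ∈ f.dom, ∃ y, K p y ∧ y ∈ g.dom ∧ ∀ r ∈ g y, ∃ z ∈ f p, H r z) :
    StrongWeihrauchLE f g := by
  obtain ⟨H', h1, h2⟩ := hH.exists_fun
  obtain ⟨K', k1, k2⟩ := hK.exists_fun
  refine ⟨H', K', h1, k1, fun G hG p hp => ?_⟩
  obtain ⟨y, hy, hyd, hr⟩ := h p hp
  obtain ⟨r, hrG, hrg⟩ := hG y hyd
  obtain ⟨z, hz, hHz⟩ := hr r hrg
  exact ⟨z, Part.mem_bind (Part.mem_bind (k2 p y hy) hrG) (h2 r z hHz), hz⟩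

theorem StrongWeihrauchLE.trans {f g h : Problem} (hfg : StrongWeihrauchLE f g)
    (hgh : StrongWeihrauchLE g h) : StrongWeihrauchLE f h := by
  obtain ⟨H₁, K₁, h1, k1, r1⟩ := hfg
  obtain ⟨H₂, K₂, h2, k2, r2⟩ := hgh
  obtain ⟨H, hH, hH'⟩ := (h1.computableRel.comp h2.computableRel).exists_fun
  obtain ⟨K, hK, hK'⟩ := (k2.computableRel.comp k1.computableRel).exists_fun
  refine ⟨H, K, hH, hK, fun G hG p hp => ?_⟩
  obtain ⟨z, hz, hzf⟩ := r1 _ (r2 G hG) p hp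
  obtain ⟨b, hb, hz⟩ := Part.mem_bind_iff.1 hz
  obtain ⟨a, ha, hb⟩ := Part.mem_bind_iff.1 hb
  obtain ⟨d, hd, hb⟩ := Part.mem_bind_iff.1 hb
  obtain ⟨c, hc, hd⟩ := Part.mem_bind_iff.1 hd
  exact ⟨z, Part.mem_bind (Part.mem_bind (hK' p c ⟨a, ha, hc⟩) hd) (hH' d z ⟨b, hb, hz⟩), hzf⟩

/-! ### Problems derived from a single-valued problem -/

/-- A problem is single-valued if every instance has at most one solution. -/
def SingleValued (f : Problem) : Prop := ∀ p, (f p).Subsingleton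

theorem singleValued_ofFun (F : Baire →. Baire) : (ofFun F).SingleValued :=
  fun _ _ hx _ hy => Part.mem_unique hx hy

/-- With `f x` a singleton, one successful path already yields the domain condition `f x ⊆ g.dom`.
-/
theorem mem_comp {f g : Problem} (hf : f.SingleValued) {x z : Baire} :
    z ∈ g.comp f x ↔ ∃ y ∈ f x, z ∈ g y := by
  constructor
  · rintro ⟨-, -, h⟩
    exact h
  · rintro ⟨y, hy, hz⟩
    refine ⟨⟨y, hy⟩, fun y' hy' => ?_, y, hy, hz⟩
    rw [hf x hy' hy]
    exact ⟨z, hz⟩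

theorem SingleValued.comp {f g : Problem} (hg : g.SingleValued) (hf : f.SingleValued) :
    (g.comp f).SingleValued := by
  intro x z hz z' hz'
  rw [mem_comp hf] at hz hz'
  obtain ⟨y, hy, hz⟩ := hz
  obtain ⟨y', hy', hz'⟩ := hz'
  rw [hf x hy' hy] at hz'
  exact hg y hz hz'

theorem SingleValued.idTimes {f : Problem} (hf : f.SingleValued) : f.idTimes.SingleValued := by
  rintro x _ ⟨r, hr, rfl⟩ _ ⟨r', hr', rfl⟩
  rw [hf _ hr hr']

theorem SingleValued.loop {f : Problem} (hf : f.SingleValued) : f.loop.SingleValued :=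
  (singleValued_ofFun univ).comp hf.idTimes

theorem mem_loop {f : Problem} (hf : f.SingleValued) {x z : Baire} :
    z ∈ f.loop x ↔ ∃ r ∈ f (right x), z ∈ Phi (left x) r := by
  rw [Problem.loop, mem_comp hf.idTimes]
  constructor
  · rintro ⟨_, ⟨r, hr, rfl⟩, hz⟩
    have hz : z ∈ univ (pair (left x) r) := hz
    rw [univ, left_pair, right_pair] at hz
    exact ⟨r, hr, hz⟩
  · rintro ⟨r, hr, hz⟩
    refine ⟨_, ⟨r, hr, rfl⟩, ?_⟩
    change z ∈ univ (pair (left x) r)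
    rwa [univ, left_pair, right_pair]

/-- Along a run every set `reach` is the singleton of the current member, which has a successor. -/
theorem mem_inverseLimit {f : Problem} (hf : f.SingleValued) {p z : Baire} :
    z ∈ f.inverseLimit p ↔
      ∃ q : ℕ → Baire, q 0 = p ∧ (∀ i, q (i + 1) ∈ f.loop (q i)) ∧ z = tuple q := by
  constructor
  · rintro ⟨-, h⟩
    exact h
  · rintro ⟨q, rfl, hq, rfl⟩
    refine ⟨fun i => ?_, q, rfl, hq, rfl⟩
    have h : ∀ i, f.reach (q 0) i = {q i} := by
      intro i
      induction i with
      | zero => rfl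
      | succ i ih =>
        rw [reach, ih]
        simp only [Set.mem_singleton_iff, Set.iUnion_iUnion_eq_left]
        exact (hf.loop (q i)).eq_singleton_of_mem (hq i)
    rw [h, Set.singleton_subset_iff]
    exact ⟨_, hq i⟩

theorem SingleValued.power {f : Problem} (hf : f.SingleValued) (n : ℕ) :
    (f.power n).SingleValued := by
  induction n using Nat.strong_induction_on with
  | _ n ih =>
    match n, ih with
    | 0, _ => exact fun p x hx y hy => hx.trans hy.symm
    | 1, _ => exact hf.idTimes
    | n + 2, ih => exact hf.idTimes.comp ((singleValued_ofFun univ).comp (ih (n + 1) (by omega)))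

/-- Each power ends before the last application of `U`. The recursion therefore unfolds into a run
`q` of the loop interleaved with the points `r (n + 1)` halfway through each pass. -/
theorem mem_omega {f : Problem} (hf : f.SingleValued) {p z : Baire} :
    z ∈ f.omega p ↔ ∃ q r : ℕ → Baire, q 0 = p ∧ r 0 = p ∧
      (∀ n, r (n + 1) ∈ f.idTimes (q n) ∧ q (n + 1) ∈ univ (r (n + 1))) ∧ z = tuple r := by
  have hsv : ∀ n, ((ofFun univ).comp (f.power (n + 1))).SingleValued := fun n =>
    (singleValued_ofFun univ).comp (hf.power (n + 1))
  have hpow : ∀ n z, z ∈ f.power (n + 2) p ↔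
      ∃ y ∈ f.power (n + 1) p, ∃ x ∈ univ y, z ∈ f.idTimes x := by
    intro n z
    rw [Problem.power, mem_comp (hsv n)]
    constructor
    · rintro ⟨x, hx, hz⟩
      rw [mem_comp (hf.power (n + 1))] at hx
      obtain ⟨y, hy, hx⟩ := hx
      exact ⟨y, hy, x, hx, hz⟩
    · rintro ⟨y, hy, x, hx, hz⟩
      exact ⟨x, (mem_comp (hf.power (n + 1))).2 ⟨y, hy, hx⟩, hz⟩
  constructor
  · rintro ⟨r, hr, rfl⟩
    have h : ∀ n, ∃ x, x ∈ univ (r (n + 1)) ∧ r (n + 2) ∈ f.idTimes x := by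
      intro n
      obtain ⟨y, hy, x, hx, hz⟩ := (hpow n _).1 (hr (n + 2))
      rw [hf.power (n + 1) p hy (hr (n + 1))] at hx
      exact ⟨x, hx, hz⟩
    choose q hq hq' using h
    -- The chosen values start with the result of the first pass, so `p` is put in front.
    refine ⟨fun n => Nat.casesOn n p q, r, rfl, hr 0, fun n => ⟨?_, hq n⟩, rfl⟩
    cases n with
    | zero => exact hr 1
    | succ n => exact hq' n
  · rintro ⟨q, r, rfl, h0, h, rfl⟩
    refine ⟨r, fun n => ?_, rfl⟩
    rcases n with _ | n
    · exact h0
    · induction n with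
      | zero => exact (h 0).1
      | succ n ih => exact (hpow n _).2 ⟨_, ih, _, (h n).2, (h (n + 1)).1⟩

theorem SingleValued.run_unique {f : Problem} (hf : f.SingleValued) {q q' : ℕ → Baire}
    (h0 : q 0 = q' 0) {k : ℕ} (hq : f.FiniteRun q k) (hq' : f.FiniteRun q' k) :
    ∀ i ≤ k, q i = q' i := by
  intro i
  induction i with
  | zero => exact fun _ => h0
  | succ i ih =>
    intro hi
    have h := hq' i hi
    rw [← ih (Nat.le_of_succ_le hi)] at h
    exact hf.loop _ (hq i hi) h

/-- Any other run from `p` agrees with the successful one as long as both last. If it reaches step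
`k`, it meets the digit `0` there; if it is shorter, it can be continued and so does not stall. -/
theorem mem_diamond {f : Problem} (hf : f.SingleValued) {p z : Baire} :
    z ∈ f.diamond p ↔
      ∃ (q : ℕ → Baire) (k : ℕ), q 0 = p ∧ f.Successful q k ∧ z = q k := by
  constructor
  · rintro ⟨-, h⟩
    exact h
  · rintro ⟨q, k, rfl, hq, rfl⟩
    refine ⟨fun q' h0 => ⟨fun k' hs => ?_, fun hi => ?_⟩, q, k, rfl, hq, rfl⟩
    · obtain ⟨hrun, hdom, hne⟩ := hs
      rcases le_or_gt k k' with h | h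
      · have e := hf.run_unique h0 (fun i hi => hrun i (hi.trans_le h)) hq.1 k le_rfl
        exact hne k h (e ▸ hq.2.1)
      · have e := hf.run_unique h0 hrun (fun i hi => hq.1 i (hi.trans h)) k' le_rfl
        exact hdom (e ▸ ⟨_, hq.1 k' h⟩)
    · have e := hf.run_unique h0 (fun i _ => hi.1 i) hq.1 k le_rfl
      exact hi.2 k (e ▸ hq.2.1)

theorem SingleValued.inverseLimit {f : Problem} (hf : f.SingleValued) :
    f.inverseLimit.SingleValued := by
  intro p z hz z' hz'
  rw [mem_inverseLimit hf] at hz hz'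
  obtain ⟨q, rfl, hq, rfl⟩ := hz
  obtain ⟨q', h0, hq', rfl⟩ := hz'
  congr 1
  funext i
  exact hf.run_unique h0.symm (fun i _ => hq i) (fun i _ => hq' i) i le_rfl

theorem SingleValued.diamond {f : Problem} (hf : f.SingleValued) : f.diamond.SingleValued := by
  intro p z hz z' hz'
  rw [mem_diamond hf] at hz hz'
  obtain ⟨q, k, rfl, hq, rfl⟩ := hz
  obtain ⟨q', k', h0, hq', rfl⟩ := hz'
  rcases lt_trichotomy k k' with h | h | h
  · have e := hf.run_unique h0 (fun i hi => hq'.1 i (hi.trans h)) hq.1 k le_rfl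
    exact absurd (e ▸ hq.2.1) (hq'.2.2 k h)
  · subst h
    exact (hf.run_unique h0 hq'.1 hq.1 k le_rfl).symm
  · have e := hf.run_unique h0 hq'.1 (fun i hi => hq.1 i (hi.trans h)) k' le_rfl
    exact absurd (e ▸ hq'.2.1) (hq.2.2 k' h)

/-! ### The inverse limit and the omega operation -/

/-- The instance is unchanged: applying `U` to each component of `F^ω` except the zeroth completes
the passes of the loop. -/
theorem inverseLimit_le_omega (F : Baire →. Baire) :
    StrongWeihrauchLE (ofFun F).inverseLimit (ofFun F).omega := by
  have hF := singleValued_ofFun F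
  have hH : ComputableRel fun z w => component z 0 = left w ∧
      ∀ i, component (right w) i ∈ univ (component z (i + 1)) := by
    refine ComputableRel.pair (ComputableMap.computableRel (f := fun z => component z 0) ?_)
      (ComputableRel.tuple (s := fun z i => component z (i + 1)) computableRel_univ ?_)
    · exact effective_component (Computable.const 0) Computable.id
    · exact effective_component (Computable.succ.comp Computable.fst) Computable.snd
  -- Reassembles the initial point and the tuple of its successors into one tuple; the truncated
  -- subtraction only occurs for `i ≠ 0`.
  have hT : ComputableMap fun w =>
      tuple fun i => if i = 0 then left w else component (right w) (i - 1) := by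
    refine ComputableMap.tuple (((Effective.of_computable (f := fun x : ℕ × ℕ => decide (x.1 = 0))
      (Primrec.eq.decide.comp Primrec.fst (Primrec.const 0)).to_comp).ite
      (Effective.comp_computable computableMap_left Computable.snd)
      (Effective.map (effective_component (Computable.pred.comp Computable.fst) Computable.snd)
        computableMap_right)).of_eq ?_)
    rintro w ⟨i, n⟩
    by_cases h : i = 0 <;> simp [h]
  refine StrongWeihrauchLE.of_computableRel (ComputableRel.map hT hH)
    computableMap_id.computableRel ?_
  rintro p ⟨z, hz⟩
  obtain ⟨q, rfl, hq, rfl⟩ := (mem_inverseLimit hF).1 hz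
  have h : ∀ n, ∃ y, y ∈ (ofFun F).idTimes (q n) ∧ q (n + 1) ∈ univ y := fun n =>
    (mem_comp hF.idTimes).1 (hq n)
  choose y hy hy' using h
  have hmem : tuple (fun n => Nat.casesOn n (q 0) y) ∈ (ofFun F).omega (q 0) :=
    (mem_omega hF).2 ⟨q, fun n => Nat.casesOn n (q 0) y, rfl, rfl, fun n => ⟨hy n, hy' n⟩, rfl⟩
  refine ⟨q 0, rfl, ⟨_, hmem⟩, fun r hr => ⟨_, hz, ?_⟩⟩
  obtain ⟨q', s, h0, hs0, hs, rfl⟩ := (mem_omega hF).1 hr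
  have hq' : ∀ n, q' n = q n := fun n => by
    refine hF.run_unique h0 (k := n) (fun i _ => ?_) (fun i _ => hq i) n le_rfl
    exact (mem_comp hF.idTimes).2 ⟨_, (hs i).1, (hs i).2⟩
  refine ⟨pair (q 0) (tuple fun i => q (i + 1)), ⟨?_, fun i => ?_⟩, ?_⟩
  · rw [component_tuple, left_pair, hs0]
  · rw [component_tuple, right_pair, component_tuple, ← hq']
    exact (hs i).2
  · rw [left_pair, right_pair]
    congr 1
    funext i
    cases i with
    | zero => rfl
    | succ i => simp [component_tuple]

theorem mem_loop_of_mem {F : Baire →. Baire} {x r z : Baire} (hr : r ∈ F (right x))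
    (hz : z ∈ Phi (left x) r) : z ∈ (ofFun F).loop x :=
  (mem_loop (singleValued_ofFun F)).2 ⟨r, hr, hz⟩

/-- Decoding all members of a sequence of encoded states. -/
theorem computableRel_decode_all : ComputableRel fun z w =>
    ∀ i, graphCode (component w i) = left (left (component z i)) := by
  refine ComputableRel.tuple (R := fun z x => graphCode x = left (left z))
    (s := fun z i => component z i) ?_ (effective_component Computable.fst Computable.snd)
  exact computableRel_graphCode_symm.comp_map (ComputableMap.left computableMap_left)

/-- A run of the loop need not reveal the values of `F` used inside its passes. The simulated states
`⟨q n, s n⟩` therefore also record the point `s n` to which `U` was last applied. -/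
theorem omega_le_inverseLimit (F : Baire →. Baire) :
    StrongWeihrauchLE (ofFun F).omega (ofFun F).inverseLimit := by
  have hF := singleValued_ofFun F
  -- On `⟨⟨q, s⟩, r⟩` this is `⟨left q, r⟩`, with `r` the answer to the query `right q`. It becomes
  -- the second half of the next state, and `U` of it the first half.
  have hs : ComputableMap fun p => pair (left (left (left p))) (right p) :=
    computableMap_left.left.left.pair computableMap_right
  obtain ⟨E, hE, hEB, hEc, hET⟩ := exists_encoding
    ((computableRel_univ.comp_map hs).pair hs.computableRel) computableMap_left.right
  have hM : ComputableMap fun w =>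
      tuple fun i => if i = 0 then left (component w i) else right (component w i) := by
    refine ComputableMap.tuple (((Effective.of_computable (f := fun x : ℕ × ℕ => decide (x.1 = 0))
      (Primrec.eq.decide.comp Primrec.fst (Primrec.const 0)).to_comp).ite
      (effective_component (i := fun x : ℕ × ℕ => x.1) (j := fun x => 2 * x.2) Computable.fst
        (Primrec.nat_mul.comp (Primrec.const 2) Primrec.snd).to_comp)
      (effective_component (i := fun x : ℕ × ℕ => x.1) (j := fun x => 2 * x.2 + 1) Computable.fst
        (Primrec.succ.comp (Primrec.nat_mul.comp (Primrec.const 2)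
          Primrec.snd)).to_comp)).of_eq ?_)
    rintro w ⟨i, n⟩
    by_cases h : i = 0 <;> simp [h, left, right]
  refine StrongWeihrauchLE.of_computableRel (computableRel_decode_all.map hM)
    (hE.comp (computableMap_id.pair computableMap_id)).computableRel ?_
  rintro p ⟨z, hz⟩
  obtain ⟨q, s, rfl, hs0, hs, rfl⟩ := (mem_omega hF).1 hz
  have hstep : ∀ n, E (pair (q (n + 1)) (s (n + 1))) ∈ (ofFun F).loop (E (pair (q n) (s n))) := by
    intro n
    obtain ⟨⟨r, hr, e⟩, hq⟩ := hs n
    refine mem_loop_of_mem (r := r) ?_ (hET _ _ _ ?_)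
    · rw [hEB, left_pair]
      exact hr
    · simp only [left_pair, right_pair]
      exact ⟨e ▸ hq, e.symm⟩
  -- No pass precedes the initial state, whose second half is filled with `q 0 = s 0`.
  have hmem : tuple (fun n => E (pair (q n) (s n))) ∈
      (ofFun F).inverseLimit (E (pair (q 0) (q 0))) :=
    (mem_inverseLimit hF).2 ⟨_, by simp only [hs0], hstep, rfl⟩
  refine ⟨_, rfl, ⟨_, hmem⟩, fun r hr => ⟨_, hz, ?_⟩⟩
  rw [hF.inverseLimit _ hr hmem]
  refine ⟨tuple fun n => pair (q n) (s n), fun i => ?_, ?_⟩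
  · rw [component_tuple, component_tuple, hEc]
  · congr 1
    funext i
    cases i with
    | zero => simp [component_tuple, left_pair, hs0]
    | succ i => simp [component_tuple, right_pair]

/-! ### The inverse limit and the parallelized diamond -/

/-- The `n`-th diamond simulates the run with a counter that starts at `n`. Its coded state begins
with `0` exactly when the counter is `0`, so it halts at the `n`-th member. -/
theorem inverseLimit_le_parallelization_diamond (F : Baire →. Baire) :
    StrongWeihrauchLE (ofFun F).inverseLimit (ofFun F).diamond.parallelization := by
  have hF := singleValued_ofFun F
  have hs : ComputableMap fun p => pair (left (right (left p))) (right p) :=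
    computableMap_left.right.left.pair computableMap_right
  have hpred : ComputableMap fun p => fun n => left (left p) n - 1 :=
    Effective.computable_comp (g := Nat.pred) Computable.pred computableMap_left.left
  obtain ⟨E, hE, hEB, hEc, hET⟩ := exists_encoding
    (hpred.computableRel.pair (computableRel_univ.comp_map hs)) computableMap_right.right
  have hM : ComputableMap fun w => tuple fun i => right (component w i) := by
    refine ComputableMap.tuple ?_
    exact effective_component (i := fun x : ℕ × ℕ => x.1) (j := fun x => 2 * x.2 + 1)
      Computable.fst
      (Primrec.succ.comp (Primrec.nat_mul.comp (Primrec.const 2) Primrec.snd)).to_comp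
  have hK : ComputableMap fun p => tuple fun n => E (pair (fun _ => n) p) := by
    refine ComputableMap.tuple (s := fun p n => E (pair (fun _ => n) p)) ?_
    refine Effective.subst (φ := fun q (x : ℕ × ℕ) => E q x.2)
      (Effective.comp_computable hE Computable.snd) (ψ := fun p x => pair (fun _ => x.1) p) ?_
    exact Effective.pair_seq (f := fun _ (x : (ℕ × ℕ) × ℕ) => x.1.1)
      (g := fun p x => p x.2)
      (Effective.of_computable (Computable.fst.comp Computable.fst))
      (Effective.comp_computable Effective.oracle Computable.snd)
  refine StrongWeihrauchLE.of_computableRel (computableRel_decode_all.map hM)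
    hK.computableRel ?_
  rintro p ⟨z, hz⟩
  obtain ⟨q, rfl, hq, rfl⟩ := (mem_inverseLimit hF).1 hz
  -- The truncated predecessor at `m = 0` is harmless, because a diamond has halted there.
  have hstep : ∀ m i, E (pair (fun _ => m - 1) (q (i + 1))) ∈
      (ofFun F).loop (E (pair (fun _ => m) (q i))) := by
    intro m i
    obtain ⟨r, hr, hq⟩ := (mem_loop hF).1 (hq i)
    refine mem_loop_of_mem (r := r) ?_ (hET _ _ _ ?_)
    · rw [hEB, right_pair]
      exact hr
    · simp only [left_pair, right_pair, true_and]
      rwa [univ, left_pair, right_pair]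
  have hzero : ∀ m x, E (pair (fun _ => m) x) 0 = 0 ↔ m = 0 := by
    intro m x
    have e : E (pair (fun _ => m) x) 0 = left (left (E (pair (fun _ => m) x))) 0 := rfl
    rw [e, hEc, graphCode_zero]
    rfl
  have hdia : ∀ n, E (pair (fun _ => 0) (q n)) ∈
      (ofFun F).diamond (E (pair (fun _ => n) (q 0))) := by
    intro n
    refine (mem_diamond hF).2 ⟨fun i => E (pair (fun _ => n - i) (q i)), n, rfl,
      ⟨fun i _ => hstep (n - i) i, ?_, fun i hi => ?_⟩, by simp only [Nat.sub_self]⟩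
    · exact (hzero _ _).2 (Nat.sub_self n)
    · rw [Ne, hzero]
      omega
  refine ⟨_, rfl, ⟨tuple fun n => E (pair (fun _ => 0) (q n)), fun n => ?_⟩,
    fun r hr => ⟨_, hz, ?_⟩⟩
  · rw [component_tuple, component_tuple]
    exact hdia n
  · refine ⟨tuple fun n => pair (fun _ => 0) (q n), fun n => ?_, ?_⟩
    · have h := hr n
      rw [component_tuple] at h
      rw [hF.diamond _ h (hdia n), hEc, component_tuple]
    · simp only [component_tuple, right_pair]

/-! ### Dovetailing the diamond runs -/

/-- The preprocessing `K` of the reduction maps the computable zero sequence into the domain of `F`,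
as one sees with `F` as its own realizer. -/
theorem exists_computable_mem_dom {F : Baire →. Baire} (h : Pointed (ofFun F)) :
    ∃ c, ComputableMap (fun _ => c) ∧ ∃ r, r ∈ F c := by
  obtain ⟨H, K, -, hK, h⟩ := h
  obtain ⟨z, hz, -⟩ := h F (fun p ⟨r, hr⟩ => ⟨r, hr, hr⟩) (fun _ => 0) ⟨_, rfl⟩
  obtain ⟨r, hr, -⟩ := Part.mem_bind_iff.1 hz
  obtain ⟨c, hc, hr⟩ := Part.mem_bind_iff.1 hr
  refine ⟨c, ?_, r, hr⟩
  have h0 : ComputableMap fun _ _ => 0 := Effective.of_computable (Computable.const 0)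
  exact EffectiveRel.mono (hK.computableRel.comp_map h0) fun _ _ _ e => ⟨c, hc, e⟩

/-- The stage counter of a state `⟨t t t …, ⟨x₀, x₁, …⟩⟩` selects one of the `xᵢ`. -/
def current (x : Baire) : Baire := component (right x) (left x 0).unpair.1

theorem effective_index {f : Baire → Baire} (hf : ComputableMap f) :
    Effective fun p (_ : ℕ × ℕ) => (f p 0).unpair.1 :=
  Effective.computable_comp (g := fun t : ℕ => t.unpair.1) (Computable.fst.comp Computable.unpair)
    (Effective.comp_computable hf (Computable.const 0))

theorem computableMap_current : ComputableMap current := by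
  have h : Effective fun (p : Baire) (n : ℕ) => Nat.pair (left p 0).unpair.1 n :=
    Effective.computable₂_comp Primrec₂.natPair.to_comp
      ((effective_index computableMap_left).comp_computable
        (Computable.pair Computable.id Computable.id))
      (Effective.of_computable Computable.id)
  exact Effective.of_eq (Effective.comp computableMap_right h) fun _ _ => rfl

theorem effective_halted {f : Baire → Baire} (hf : ComputableMap f) :
    Effective fun p (_ : ℕ) => decide (f p 0 = 0) :=
  Effective.computable_comp (g := fun b : ℕ => decide (b = 0))
    (Primrec.eq.decide.comp Primrec.id (Primrec.const 0)).to_comp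
    (Effective.comp_computable hf (Computable.const 0))

/-- One step of the run that the stage counter selects, if that run has not yet been successful. -/
def Advance (p z : Baire) : Prop :=
  if current (left p) 0 = 0 then current (left p) = z
  else z ∈ univ (pair (left (current (left p))) (right p))

theorem computableRel_advance : ComputableRel Advance := by
  have hc : ComputableMap fun p => current (left p) := computableMap_current.comp computableMap_left
  refine (EffectiveRel.ite (effective_halted hc) hc.computableRel
    (computableRel_univ.comp_map (hc.left.pair computableMap_right))).mono ?_
  rintro p n b ⟨z, hz, rfl⟩
  unfold Advance at hz
  by_cases h : current (left p) 0 = 0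
  · simp only [h, if_true, decide_true] at hz ⊢
    exact ⟨z, hz, rfl⟩
  · simp only [h, if_false, decide_false, Bool.false_eq_true] at hz ⊢
    exact ⟨z, hz, rfl⟩

/-- The state after the state `x` if the selected member is replaced by `z`. -/
def updateState (x z : Baire) : Baire :=
  pair (fun n => left x n + 1)
    (tuple fun i => if i = (left x 0).unpair.1 then z else component (right x) i)

theorem computableMap_updateState {f g : Baire → Baire} (hf : ComputableMap f)
    (hg : ComputableMap g) : ComputableMap fun p => updateState (f p) (g p) := by
  refine ComputableMap.pair
    (Effective.computable_comp Computable.succ hf.left) (ComputableMap.tuple ?_)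
  refine ((Effective.computable₂_comp (h := fun a b : ℕ => decide (a = b))
    Primrec.eq.decide.to_comp (Effective.of_computable (Computable.fst (α := ℕ) (β := ℕ)))
    (effective_index hf.left)).ite (Effective.comp_computable hg Computable.snd)
    (Effective.map (effective_component Computable.fst Computable.snd) hf.right)).of_eq ?_
  rintro p ⟨i, n⟩
  by_cases h : i = (left (f p) 0).unpair.1 <;> simp [h]

/-- The first value of each run that signals success. -/
theorem computableRel_first_success : ComputableRel fun w y => ∀ j, ∃ t,
    component (right (component w t)) j 0 = 0 ∧
    (∀ s < t, component (right (component w s)) j 0 ≠ 0) ∧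
    component y j = component (right (component w t)) j := by
  have hv : Effective fun (w : Baire) (x : (ℕ × ℕ) × ℕ) =>
      component (right (component w x.2)) x.1.1 x.1.2 :=
    effective_component (i := fun x : (ℕ × ℕ) × ℕ => x.2)
      (j := fun x => 2 * Nat.pair x.1.1 x.1.2 + 1) Computable.snd
      (Primrec.succ.comp (Primrec.nat_mul.comp (Primrec.const 2)
        (Primrec₂.natPair.comp (Primrec.fst.comp Primrec.fst)
          (Primrec.snd.comp Primrec.fst)))).to_comp
  have hc : Effective fun (w : Baire) (x : (ℕ × ℕ) × ℕ) =>
      decide (component (right (component w x.2)) x.1.1 0 = 0) :=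
    Effective.computable_comp (g := fun b : ℕ => decide (b = 0))
      (Primrec.eq.decide.comp Primrec.id (Primrec.const 0)).to_comp
      (hv.comp_computable (f := fun x : (ℕ × ℕ) × ℕ => ((x.1.1, 0), x.2))
        (Computable.pair (Computable.pair (Computable.fst.comp Computable.fst)
          (Computable.const 0)) Computable.snd))
  have hpair := EffectiveRel.graph (Effective.find hc)
  refine (EffectiveRel.comp_fun (EffectiveRel.comp hv hpair)
    (Effective.of_computable Computable.unpair)).mono ?_
  rintro w n b ⟨y, hy, rfl⟩
  obtain ⟨t, h1, h2, h3⟩ := hy n.unpair.1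
  refine ⟨(n.unpair, t), ⟨rfl, by simpa using h1, fun k hk => by simpa using h2 k hk⟩, ?_⟩
  simp only [← h3]
  simp [component]

/-- The number of steps that the `j`-th run has made at stage `t`, if it has `k j` steps. -/
def progress (k : ℕ → ℕ) : ℕ → ℕ → ℕ
  | 0, _ => 0
  | t + 1, j => if j = t.unpair.1 ∧ progress k t j < k j then progress k t j + 1 else progress k t j

theorem progress_le (k : ℕ → ℕ) (t j : ℕ) : progress k t j ≤ k j := by
  induction t with
  | zero => exact Nat.zero_le _
  | succ t ih =>
    rw [progress]
    split_ifs with h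
    · exact h.2
    · exact ih

theorem monotone_progress (k : ℕ → ℕ) (j : ℕ) : Monotone fun t => progress k t j :=
  monotone_nat_of_le_succ fun t => by
    simp only [progress]
    split_ifs <;> omega

/-- The run `j` is selected at every stage `Nat.pair j t`, and this is at least `t`; hence it
advances again until all its steps are made. -/
theorem exists_progress_eq (k : ℕ → ℕ) (j : ℕ) : ∃ t, progress k t j = k j := by
  have h : ∀ m ≤ k j, ∃ t, m ≤ progress k t j := by
    intro m
    induction m with
    | zero => exact fun _ => ⟨0, Nat.zero_le _⟩
    | succ m ih =>
      intro hm
      obtain ⟨t, ht⟩ := ih (by omega)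
      have hle : progress k t j ≤ progress k (Nat.pair j t) j :=
        monotone_progress k j (Nat.right_le_pair j t)
      refine ⟨Nat.pair j t + 1, ?_⟩
      rw [progress, Nat.unpair_pair]
      split_ifs with h
      · omega
      · simp only [true_and, not_lt] at h
        omega
  obtain ⟨t, ht⟩ := h (k j) le_rfl
  exact ⟨t, le_antisymm (progress_le k t j) ht⟩

/-- A state holds a stage counter and the current members of all runs, and pass `t` advances the run
`t.unpair.1`. Every run halts on the domain of the diamond, so its result appears at the first stage
where its member begins with `0`. -/
theorem parallelization_diamond_le_inverseLimit {F : Baire →. Baire} (hP : Pointed (ofFun F)) :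
    StrongWeihrauchLE (ofFun F).diamond.parallelization (ofFun F).inverseLimit := by
  have hF := singleValued_ofFun F
  obtain ⟨c, hc, v, hv⟩ := exists_computable_mem_dom hP
  -- The oracle `p = ⟨state, answer⟩` is kept as `left w` beside the advanced member `right w`,
  -- because the update needs the old state as well.
  have hT : ComputableRel fun p y => ∃ w, (p = left w ∧ Advance p (right w)) ∧
      updateState (left (left w)) (right w) = y :=
    (computableMap_id.computableRel.pair computableRel_advance).map
      (computableMap_updateState computableMap_left.left computableMap_right)
  -- A halted run still has to query `F`; it asks for the value at `c` and ignores it.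
  have hB : ComputableMap fun x => if current x 0 = 0 then c else right (current x) :=
    ((effective_halted computableMap_current).ite hc computableMap_current.right).of_eq
      fun x n => by by_cases h : current x 0 = 0 <;> simp [h]
  obtain ⟨E, hE, hEB, hEc, hET⟩ := exists_encoding hT hB
  have h0 : ComputableMap fun _ _ => 0 := Effective.of_computable (Computable.const 0)
  refine StrongWeihrauchLE.of_computableRel
    (computableRel_first_success.comp computableRel_decode_all)
    (hE.comp (h0.pair computableMap_id)).computableRel ?_
  rintro p ⟨z, hz⟩
  have h : ∀ j, ∃ (q : ℕ → Baire) (k : ℕ), q 0 = component p j ∧ (ofFun F).Successful q k ∧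
      component z j = q k := fun j => (mem_diamond hF).1 (hz j)
  choose q k hq0 hq hqz using h
  have halted : ∀ t j, q j (progress k t j) 0 = 0 ↔ progress k t j = k j := by
    intro t j
    constructor
    · intro h
      by_contra hne
      exact (hq j).2.2 _ (lt_of_le_of_ne (progress_le k t j) hne) h
    · intro h
      rw [h]
      exact (hq j).2.1
  let x : ℕ → Baire := fun t => pair (fun _ => t) (tuple fun j => q j (progress k t j))
  have hcur : ∀ t, current (x t) = q t.unpair.1 (progress k t t.unpair.1) := by
    intro t
    simp only [x, current, left_pair, right_pair, component_tuple]
  -- Only the selected run can make progress, so replacing its member gives the whole next state.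
  have hupd : ∀ t, updateState (x t) (q t.unpair.1 (progress k (t + 1) t.unpair.1)) = x (t + 1) := by
    intro t
    simp only [x, updateState, left_pair, right_pair, component_tuple]
    congr 2
    funext j
    split_ifs with h
    · rw [h]
    · rw [progress, if_neg fun h' => h h'.1]
  have hstep : ∀ t, E (x (t + 1)) ∈ (ofFun F).loop (E (x t)) := by
    intro t
    by_cases hh : progress k t t.unpair.1 = k t.unpair.1
    · have h0 : current (x t) 0 = 0 := by rw [hcur, halted, hh]
      refine mem_loop_of_mem (r := v) ?_ (hET _ _ _ ?_)
      · rwa [hEB, if_pos h0]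
      · refine ⟨pair (pair (x t) v) (current (x t)), ⟨(left_pair _ _).symm, ?_⟩, ?_⟩
        · rw [Advance, left_pair, right_pair, if_pos h0]
        · rw [left_pair, left_pair, right_pair, ← hupd, hcur, progress, if_neg]
          omega
    · have hlt : progress k t t.unpair.1 < k t.unpair.1 := lt_of_le_of_ne (progress_le _ _ _) hh
      have h0 : current (x t) 0 ≠ 0 := by rwa [hcur, Ne, halted]
      obtain ⟨r, hr, hq'⟩ := (mem_loop hF).1 ((hq t.unpair.1).1 _ hlt)
      refine mem_loop_of_mem (r := r) ?_ (hET _ _ _ ?_)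
      · rw [hEB, if_neg h0, hcur]
        exact hr
      · refine ⟨pair (pair (x t) r) (q t.unpair.1 (progress k (t + 1) t.unpair.1)),
          ⟨(left_pair _ _).symm, ?_⟩, ?_⟩
        · rw [Advance, left_pair, right_pair, right_pair, if_neg h0, hcur, univ, left_pair,
            right_pair, progress, if_pos ⟨rfl, hlt⟩]
          exact hq'
        · rw [left_pair, left_pair, right_pair, hupd]
  have hx0 : x 0 = pair (fun _ => 0) p := by
    have : (fun j => q j (progress k 0 j)) = component p := funext fun j => hq0 j
    simp only [x, this, tuple_component]
  have hmem : tuple (fun t => E (x t)) ∈ (ofFun F).inverseLimit (E (pair (fun _ => 0) p)) :=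
    (mem_inverseLimit hF).2 ⟨_, by simp only [hx0], hstep, rfl⟩
  refine ⟨_, rfl, ⟨_, hmem⟩, fun r hr => ⟨z, hz, ?_⟩⟩
  rw [hF.inverseLimit _ hr hmem]
  refine ⟨tuple x, fun t => ?_, fun j => ?_⟩
  · rw [component_tuple, component_tuple, hEc]
  · have hval : ∀ t, component (right (component (tuple x) t)) j = q j (progress k t j) := fun t => by
      simp only [component_tuple, x, right_pair]
    -- By `halted`, a first digit `0` appears only when the run is complete, so the first such stage
    -- shows the final value `q j (k j)`.
    have hex : ∃ t, q j (progress k t j) 0 = 0 :=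
      (exists_progress_eq k j).imp fun t ht => (halted t j).2 ht
    refine ⟨Nat.find hex, ?_, fun s hs => ?_, ?_⟩
    · rw [hval]
      exact Nat.find_spec hex
    · rw [hval]
      exact Nat.find_min hex hs
    · rw [hval, hqz, (halted _ j).1 (Nat.find_spec hex)]

end Problem

end Weihrauch

theorem proposition20 (F : Weihrauch.Baire →. Weihrauch.Baire) :
    Weihrauch.Problem.StrongWeihrauchEquiv
        (Weihrauch.Problem.ofFun F).omega (Weihrauch.Problem.ofFun F).inverseLimit ∧
      (Weihrauch.Problem.Pointed (Weihrauch.Problem.ofFun F) →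
        Weihrauch.Problem.StrongWeihrauchEquiv
            (Weihrauch.Problem.ofFun F).inverseLimit (Weihrauch.Problem.ofFun F).omega ∧
          Weihrauch.Problem.StrongWeihrauchEquiv
            (Weihrauch.Problem.ofFun F).omega
            (Weihrauch.Problem.ofFun F).diamond.parallelization) := by
  have h₁ := Weihrauch.Problem.omega_le_inverseLimit F
  have h₂ := Weihrauch.Problem.inverseLimit_le_omega F
  refine ⟨⟨h₁, h₂⟩, fun hP => ⟨⟨h₂, h₁⟩, ?_, ?_⟩⟩
  · exact h₁.trans (Weihrauch.Problem.inverseLimit_le_parallelization_diamond F)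
  · exact (Weihrauch.Problem.parallelization_diamond_le_inverseLimit hP).trans h₂
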